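/- Let $0<p<1/2$ and let $X_1,X_2,\dots$ be i.i.d. Bernoulli-$p$ bits. Write $H(p)=-p\log_2 p-(1-p)\log_2(1-p)$. An $(R_0,R,n)$ code encodes $X^n$ and a secret key $\omega$, uniform on $\{1,\dots,\lfloor 2^{nR_0}\rfloor\}$ and independent of $X^n$, into a message $I\in\{1,\dots,\lfloor 2^{nR}\rfloor\}$, and decodes $\hat X^n$ from $(I,\omega)$. Encoder and decoder are either both required to be deterministic functions, or allowed to use local randomization; all statements below hold for each of these two classes of codes. The distortion forced by a code on a causal eavesdropper is $$\frac1n\sum_{q=1}^n\ \min_{z}\ \mathbf P\bigl(X_q\neq z(I,X^{q-1})\bigr),$$ the minimum being over all functions $z$ of $(I,X^{q-1})$ with values in $\{0,1\}$. A triple $(R_0,R,D)$ is achievable if there are $(R_0,R,n)$ codes, $n=1,2,\dots$, with $\mathbf P(\hat X^n=X^n)\to1$, each forcing distortion at least $D$; let $\mathcal S$ be the closure of the set of achievable triples, and call the largest $D$ with $(R_0,R,D)\in\mathcal S$ the optimal forced distortion at $(R_0,R)$. Let $R\ge H(p)$. Then: 1. If $0\le R_0<2p$, the optimal forced distortion at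 $(R_0,R)$ is $R_0/2$. 2. If $R_0\ge 2p$, the optimal forced distortion at $(R_0,R)$ is $p$; moreover $2p<H(p)$. Thus the full distortion $p$ is forced with key rate only $2p<H(p)$. 3. Every code of length $n\ge1$ (with at least one key value) that has perfect secrecy, i.e. $I$ independent of $X^n$, forces distortion exactly $p$; and the least $R_0$ such that $(R_0,R)$ is in the closure of the rate pairs allowing codes with perfect secrecy for every $n$ and $\mathbf P(\hat X^n=X^n)\to1$ is $H(p)$. 4. Naively hiding a prefix is strictly suboptimal when $0<R_0<H(p)$: let $\mathcal S_{\mathrm{naive}}$ be defined as $\mathcal S$, but only with sequences of codes for which there are prefix lengths $m_n\le n$ such that $X^{m_n}$ is independent of $I$ (the prefix is perfectly hidden) and, for some functions $r_n$, $\mathbf P\bigl(r_n(I)=(X_{m_n+1},\dots,X_n)\bigr)\to1$ (the rest is revealed). Then the largest $D$ with $(R_0,R,D)\in\mathcal S_{\mathrm{naive}}$ is $pR_0/H(p)$, which is strictly smaller than the optimal forced distortion at $(R_0,R)$. -/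

import Mathlib

open Filter Topology

noncomputable section

namespace PartialSecrecy

/-- The number of elements of `[2^{nR}]`, for block length `n` and rate `R` (bits per symbol). -/
def numValues (n : ℕ) (R : ℝ) : ℕ := ⌊(2 : ℝ) ^ ((n : ℝ) * R)⌋₊

/-- A block code for sequences of length `n` over the alphabet `𝒳`, with `K` values of the secret
key and `M` messages. The encoder gives, for a source sequence and a key, a distribution on
messages; the decoder gives, for a message and a key, a distribution on reconstructions. -/
structure Code (𝒳 : Type) [Fintype 𝒳] (n K M : ℕ) where
  enc : (Fin n → 𝒳) → Fin K → stdSimplex ℝ (Fin M)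
  dec : Fin M → Fin K → stdSimplex ℝ (Fin n → 𝒳)

/-- Whether codes consist of functions, or may use local randomization at both ends. -/
inductive CodeClass
  | deterministic
  | randomized

namespace Code

variable {𝒳 𝒵 : Type} [Fintype 𝒳] {n K M : ℕ}

open Classical in
/-- The code is given by an encoding function `f` and a decoding function `g`. -/
def IsDeterministic (c : Code 𝒳 n K M) : Prop :=
  ∃ (f : (Fin n → 𝒳) → Fin K → Fin M) (g : Fin M → Fin K → (Fin n → 𝒳)),
    (∀ x ω i, (c.enc x ω).1 i = if f x ω = i then 1 else 0) ∧
    (∀ i ω x, (c.dec i ω).1 x = if g i ω = x then 1 else 0)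

/-- Membership of a code in the given class. -/
def InClass (c : Code 𝒳 n K M) : CodeClass → Prop
  | .deterministic => c.IsDeterministic
  | .randomized => True

/-- `P (X^n = x, I = i)`, when `X^n` is i.i.d. with mass function `p₀`, the key is uniform on
`[K]` and independent of `X^n`, and `I` is the transmitted message. -/
def jointProb (c : Code 𝒳 n K M) (p₀ : 𝒳 → ℝ) (x : Fin n → 𝒳) (i : Fin M) : ℝ :=
  (∏ j, p₀ (x j)) * ∑ ω : Fin K, (K : ℝ)⁻¹ * (c.enc x ω).1 i

open Classical in
/-- `P (A (X^n, I))` for an event `A` about the source sequence and the message. -/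
def prob (c : Code 𝒳 n K M) (p₀ : 𝒳 → ℝ) (A : (Fin n → 𝒳) → Fin M → Prop) : ℝ :=
  ∑ x, ∑ i, if A x i then c.jointProb p₀ x i else 0

/-- `P (X̂^n = X^n)`. -/
def successProb (c : Code 𝒳 n K M) (p₀ : 𝒳 → ℝ) : ℝ :=
  ∑ x : Fin n → 𝒳, ∑ ω : Fin K, ∑ i : Fin M,
    (∏ j, p₀ (x j)) * (K : ℝ)⁻¹ * (c.enc x ω).1 i * (c.dec i ω).1 x

/-- The symbols `x^{q-1}` that precede position `q`. -/
def past (x : Fin n → 𝒳) (q : Fin n) : Fin q.val → 𝒳 :=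
  fun j => x (Fin.castLE q.isLt.le j)

/-- `E d(X_q, z(I, X^{q-1}))`. -/
def expectedDistortion (c : Code 𝒳 n K M) (p₀ : 𝒳 → ℝ) (d : 𝒳 → 𝒵 → ℝ) (q : Fin n)
    (z : Fin M → (Fin q.val → 𝒳) → 𝒵) : ℝ :=
  ∑ x, ∑ i, c.jointProb p₀ x i * d (x q) (z i (past x q))

/-- `(1/n) ∑_q min_z E d(X_q, z(I, X^{q-1}))`: the distortion that the code forces on a causal
eavesdropper. (For a finite nonempty reconstruction alphabet the infimum is a minimum.) -/
def forcedDistortion (c : Code 𝒳 n K M) (p₀ : 𝒳 → ℝ) (d : 𝒳 → 𝒵 → ℝ) : ℝ :=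
  (n : ℝ)⁻¹ * ∑ q : Fin n,
    ⨅ z : Fin M → (Fin q.val → 𝒳) → 𝒵, c.expectedDistortion p₀ d q z

/-- The first `m` source symbols are perfectly hidden: they are independent of the message. -/
def HidesPrefix (c : Code 𝒳 n K M) (p₀ : 𝒳 → ℝ) (m : ℕ) : Prop :=
  ∀ (u : Fin n → 𝒳) (i : Fin M),
    c.prob p₀ (fun x i' => (∀ j : Fin n, j.val < m → x j = u j) ∧ i' = i) =
      c.prob p₀ (fun x _ => ∀ j : Fin n, j.val < m → x j = u j) *
        c.prob p₀ (fun _ i' => i' = i)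

/-- Perfect secrecy: the whole source sequence is independent of the message. -/
def PerfectlySecret (c : Code 𝒳 n K M) (p₀ : 𝒳 → ℝ) : Prop := c.HidesPrefix p₀ n

/-- The probability that the estimate `r(I)`, formed without the key, is right about all source
symbols after the first `m`. -/
def revealProb (c : Code 𝒳 n K M) (p₀ : 𝒳 → ℝ) (m : ℕ) (r : Fin M → Fin n → 𝒳) : ℝ :=
  c.prob p₀ (fun x i => ∀ j : Fin n, m ≤ j.val → r i j = x j)

end Code

section Regions

variable {𝒳 𝒵 : Type} [Fintype 𝒳]

/-- The rate pair `(R₀, R)` can force distortion `D`: there are `(R₀, R, n)` codes for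
`n = 1, 2, …` with asymptotically lossless transmission and forced distortion at least `D`. -/
def CanForce (k : CodeClass) (p₀ : 𝒳 → ℝ) (d : 𝒳 → 𝒵 → ℝ) (R₀ R D : ℝ) : Prop :=
  ∃ c : ∀ n : ℕ, Code 𝒳 n (numValues n R₀) (numValues n R),
    (∀ n, (c n).InClass k) ∧
    Tendsto (fun n => (c n).successProb p₀) atTop (𝓝 1) ∧
    ∀ n, 1 ≤ n → D ≤ (c n).forcedDistortion p₀ d

/-- The secrecy rate-distortion region: the closure of the achievable triples `(R₀, R, D)`. -/
def secrecyRegion (k : CodeClass) (p₀ : 𝒳 → ℝ) (d : 𝒳 → 𝒵 → ℝ) : Set (ℝ × ℝ × ℝ) :=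
  closure {t | CanForce k p₀ d t.1 t.2.1 t.2.2}

/-- As `CanForce`, but by naive use of the key: a prefix of the sequence (of length `m n`) is
perfectly hidden, and the rest is revealed to everyone, with probability tending to one. -/
def CanForceNaively (k : CodeClass) (p₀ : 𝒳 → ℝ) (d : 𝒳 → 𝒵 → ℝ) (R₀ R D : ℝ) : Prop :=
  ∃ (c : ∀ n : ℕ, Code 𝒳 n (numValues n R₀) (numValues n R)) (m : ℕ → ℕ)
    (r : ∀ n : ℕ, Fin (numValues n R) → Fin n → 𝒳),
    (∀ n, (c n).InClass k) ∧
    (∀ n, m n ≤ n) ∧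
    (∀ n, (c n).HidesPrefix p₀ (m n)) ∧
    Tendsto (fun n => (c n).revealProb p₀ (m n) (r n)) atTop (𝓝 1) ∧
    Tendsto (fun n => (c n).successProb p₀) atTop (𝓝 1) ∧
    ∀ n, 1 ≤ n → D ≤ (c n).forcedDistortion p₀ d

/-- The closure of the triples `(R₀, R, D)` achievable by naive prefix hiding. -/
def naiveRegion (k : CodeClass) (p₀ : 𝒳 → ℝ) (d : 𝒳 → 𝒵 → ℝ) : Set (ℝ × ℝ × ℝ) :=
  closure {t | CanForceNaively k p₀ d t.1 t.2.1 t.2.2}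

/-- The closure of the rate pairs `(R₀, R)` at which asymptotically lossless transmission with
perfect secrecy is possible. -/
def perfectSecrecyRegion (k : CodeClass) (p₀ : 𝒳 → ℝ) : Set (ℝ × ℝ) :=
  closure {t | ∃ c : ∀ n : ℕ, Code 𝒳 n (numValues n t.1) (numValues n t.2),
    (∀ n, (c n).InClass k) ∧
    (∀ n, (c n).PerfectlySecret p₀) ∧
    Tendsto (fun n => (c n).successProb p₀) atTop (𝓝 1)}

end Regions

/-- The Bernoulli-`p` mass function on bits. -/
def bernoulli (p : ℝ) : Bool → ℝ := fun b => if b then p else 1 - p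

/-- Hamming distortion on bits. -/
def hamming : Bool → Bool → ℝ := fun x z => if x = z then 0 else 1

/-- The binary entropy function, in bits. -/
def binaryEntropy (p : ℝ) : ℝ := Real.binEntropy p / Real.log 2

end PartialSecrecy

end

/-!
Converse: the message leaves at most `K ≈ 2 ^ (n * R₀)` candidate sequences, one for each key. An
eavesdropper who predicts every symbol by a weighted majority vote among the candidates consistent
with the past errs, on average, at most `log₂ K / 2` times, because a symbol mispredicted with
probability `a ≤ 1 / 2` carries at least `2 * a` bits about the candidate. So the forced distortion
is at most `R₀ / 2`, besides the trivial bound `p`.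

Achievability: cover the typical sequences by subcubes of dimension `2 * l ≈ n * R₀` of the Hamming
cube, reveal the subcube, and encrypt the position inside it by a one-time pad. A causal predictor
then errs on about `l` of the `2 * l` free positions. Covers by about `2 ^ (n * H(p)) / 4 ^ l`
subcubes exist by greedy choice, because an interval between levels `w - l` and `w + l` contains
`(2 * l).choose l ≈ 4 ^ l` sets of size `w`.

Perfectly hiding a prefix of length `m` costs, by Shannon's argument, `m * H(p)` bits of key, and
the revealed suffix contributes no distortion. Since `H(p) > 2 * p`, this is a worse exchange of key
for distortion.
-/

noncomputable section

namespace PartialSecrecy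

/-! ### Independent identically distributed sequences -/

section Source

variable {α ι : Type*} [Fintype ι] {p₀ : α → ℝ}

/-- The probability of a family of independent symbols, each with mass function `p₀`. -/
def iidProb (p₀ : α → ℝ) (x : ι → α) : ℝ := ∏ j, p₀ (x j)

lemma iidProb_nonneg (hp₀ : ∀ a, 0 ≤ p₀ a) (x : ι → α) : 0 ≤ iidProb p₀ x :=
  Finset.prod_nonneg fun _ _ => hp₀ _

lemma log_iidProb {x : ι → α} (hx : iidProb p₀ x ≠ 0) :
    Real.log (iidProb p₀ x) = ∑ j, Real.log (p₀ (x j)) :=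
  Real.log_prod fun j _ => (Finset.prod_ne_zero_iff.1 hx) j (Finset.mem_univ j)

lemma iidProb_update [DecidableEq ι] (x : ι → α) (j : ι) (a : α) :
    iidProb p₀ (Function.update x j a) * p₀ (x j) = iidProb p₀ x * p₀ a := by
  rw [iidProb, iidProb, ← Finset.mul_prod_erase _ _ (Finset.mem_univ j),
    ← Finset.mul_prod_erase _ (fun i => p₀ (x i)) (Finset.mem_univ j), Function.update_self,
    Finset.prod_congr rfl fun i hi => by
      rw [Function.update_of_ne (Finset.ne_of_mem_erase hi)]]
  ring

variable [Fintype α]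

lemma nonempty_of_sum_eq_one (hp₀ : ∑ a, p₀ a = 1) : Nonempty α :=
  not_isEmpty_iff.1 fun _ => by simp at hp₀

/-- The Shannon entropy of a mass function, in nats. -/
def entropy (p₀ : α → ℝ) : ℝ := ∑ a, Real.negMulLog (p₀ a)

/-- The variance of the information content `-log p₀ a` of a random symbol; it controls the
probability of atypical sequences. -/
def varentropy (p₀ : α → ℝ) : ℝ := ∑ a, p₀ a * (-Real.log (p₀ a) - entropy p₀) ^ 2

lemma varentropy_nonneg (hp₀ : ∀ a, 0 ≤ p₀ a) : 0 ≤ varentropy p₀ :=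
  Finset.sum_nonneg fun a _ => mul_nonneg (hp₀ a) (sq_nonneg _)

lemma entropy_nonneg (hp₀ : p₀ ∈ stdSimplex ℝ α) : 0 ≤ entropy p₀ :=
  Finset.sum_nonneg fun a _ =>
    Real.negMulLog_nonneg (hp₀.1 a) ((mem_Icc_of_mem_stdSimplex hp₀ a).2)

lemma sum_iidProb [DecidableEq ι] (hp₀ : ∑ a, p₀ a = 1) : ∑ x : ι → α, iidProb p₀ x = 1 := by
  simp only [iidProb]
  rw [← Fintype.piFinset_univ, ← Finset.prod_univ_sum, Finset.prod_eq_one fun _ _ => hp₀]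

lemma sum_iidProb_resample [DecidableEq ι] (hp₀ : ∑ a, p₀ a = 1) (j : ι)
    (f : (ι → α) → ℝ) :
    ∑ x : ι → α, iidProb p₀ x * ∑ a, p₀ a * f (Function.update x j a) =
      ∑ x, iidProb p₀ x * f x := by
  let swap : (ι → α) × α → (ι → α) × α := fun y => (Function.update y.1 j y.2, y.1 j)
  have hswap : Function.Involutive swap := fun y => by simp [swap]
  calc ∑ x : ι → α, iidProb p₀ x * ∑ a, p₀ a * f (Function.update x j a)
      = ∑ y : (ι → α) × α, iidProb p₀ (swap y).1 * p₀ (swap y).2 * f (swap y).1 := by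
        simp only [swap, iidProb_update, Fintype.sum_prod_type, Finset.mul_sum, mul_assoc]
    _ = ∑ y : (ι → α) × α, iidProb p₀ y.1 * p₀ y.2 * f y.1 :=
        Function.Bijective.sum_comp hswap.bijective
          fun y : (ι → α) × α => iidProb p₀ y.1 * p₀ y.2 * f y.1
    _ = ∑ x, iidProb p₀ x * f x := by
        simp only [Fintype.sum_prod_type, mul_right_comm _ (p₀ _), ← Finset.mul_sum, hp₀, mul_one]

lemma sum_iidProb_mul_apply [DecidableEq ι] (hp₀ : ∑ a, p₀ a = 1) (f : α → ℝ) (j : ι) :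
    ∑ x : ι → α, iidProb p₀ x * f (x j) = ∑ a, p₀ a * f a := by
  rw [← sum_iidProb_resample hp₀ j]
  simp only [Function.update_self, ← Finset.sum_mul, sum_iidProb hp₀, one_mul]

lemma sum_iidProb_mul_sum_sq [DecidableEq ι] (hp₀ : ∑ a, p₀ a = 1) {g : α → ℝ}
    (hg : ∑ a, p₀ a * g a = 0) :
    ∑ x : ι → α, iidProb p₀ x * (∑ j, g (x j)) ^ 2 =
      Fintype.card ι * ∑ a, p₀ a * g a ^ 2 := by
  have offDiagonal : ∀ i j : ι, i ≠ j →
      ∑ x : ι → α, iidProb p₀ x * (g (x i) * g (x j)) = 0 := fun i j hij => by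
    rw [← sum_iidProb_resample hp₀ j]
    refine Finset.sum_eq_zero fun x _ => ?_
    simp only [Function.update_self, Function.update_of_ne hij, mul_left_comm _ (g (x i)),
      ← Finset.mul_sum, hg, mul_zero]
  have diagonal : ∀ i : ι,
      ∑ j, ∑ x : ι → α, iidProb p₀ x * (g (x i) * g (x j)) = ∑ a, p₀ a * g a ^ 2 := fun i => by
    rw [Finset.sum_eq_single i (fun j _ hj => offDiagonal i j hj.symm) (by simp)]
    simp only [← pow_two]
    exact sum_iidProb_mul_apply hp₀ (fun a => g a ^ 2) i
  calc ∑ x : ι → α, iidProb p₀ x * (∑ j, g (x j)) ^ 2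
      = ∑ i, ∑ j, ∑ x : ι → α, iidProb p₀ x * (g (x i) * g (x j)) := by
        rw [Finset.sum_congr rfl fun x _ => by rw [pow_two, Finset.sum_mul_sum, Finset.mul_sum],
          Finset.sum_comm]
        simp only [Finset.mul_sum]
        exact Finset.sum_congr rfl fun i _ => Finset.sum_comm
    _ = Fintype.card ι * ∑ a, p₀ a * g a ^ 2 := by
        simp only [diagonal, Finset.sum_const, Finset.card_univ, nsmul_eq_mul]

lemma sum_iidProb_le_one (hp₀ : p₀ ∈ stdSimplex ℝ α) (s : Finset (ι → α)) :
    ∑ x ∈ s, iidProb p₀ x ≤ 1 := by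
  classical
  exact sum_iidProb (ι := ι) hp₀.2 ▸
    Finset.sum_le_univ_sum_of_nonneg fun x => iidProb_nonneg hp₀.1 x

end Source

section Typical

variable {α ι : Type*} [Fintype α] [Fintype ι] {p₀ : α → ℝ} {b : ℝ}

variable (ι) in
open Classical in
/-- The sequences whose probability is within a factor `exp b` of `exp (-n H)`, `n` being the number
of symbols and `H` the entropy. The condition is on the probability itself, not its logarithm, so
that sequences of probability zero are left out. -/
def typical (p₀ : α → ℝ) (b : ℝ) : Finset (ι → α) :=
  {x | iidProb p₀ x ∈ Set.Icc (Real.exp (-(Fintype.card ι * entropy p₀) - b))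
    (Real.exp (-(Fintype.card ι * entropy p₀) + b))}

lemma mem_typical {x : ι → α} : x ∈ typical ι p₀ b ↔
    Real.exp (-(Fintype.card ι * entropy p₀) - b) ≤ iidProb p₀ x ∧
      iidProb p₀ x ≤ Real.exp (-(Fintype.card ι * entropy p₀) + b) := by
  simp [typical]

lemma lt_abs_sum_information_of_notMem_typical (hp₀ : ∀ a, 0 ≤ p₀ a) {x : ι → α}
    (hx : iidProb p₀ x ≠ 0) (hxb : x ∉ typical ι p₀ b) :
    b < |∑ j, (-Real.log (p₀ (x j)) - entropy p₀)| := by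
  contrapose! hxb
  have hpos : 0 < iidProb p₀ x := (iidProb_nonneg hp₀ x).lt_of_ne' hx
  rw [Finset.sum_sub_distrib, Finset.sum_neg_distrib, ← log_iidProb hx, Finset.sum_const,
    Finset.card_univ, nsmul_eq_mul, abs_le] at hxb
  rw [mem_typical, ← Real.le_log_iff_exp_le hpos, ← Real.log_le_iff_le_exp hpos]
  constructor <;> linarith [hxb.1, hxb.2]

lemma sum_information_eq_zero (hp₀ : ∑ a, p₀ a = 1) :
    ∑ a, p₀ a * (-Real.log (p₀ a) - entropy p₀) = 0 := by
  simp only [mul_sub, Finset.sum_sub_distrib, ← Finset.sum_mul, hp₀, entropy, Real.negMulLog,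
    one_mul, mul_neg, neg_mul, sub_self]

lemma sum_iidProb_le_of_disjoint_typical (hp₀ : p₀ ∈ stdSimplex ℝ α) (hb : 0 < b)
    {s : Finset (ι → α)} (hs : Disjoint s (typical ι p₀ b)) :
    ∑ x ∈ s, iidProb p₀ x ≤ Fintype.card ι * varentropy p₀ / b ^ 2 := by
  classical
  rw [le_div_iff₀ (by positivity), varentropy,
    ← sum_iidProb_mul_sum_sq hp₀.2 (sum_information_eq_zero hp₀.2), Finset.sum_mul]
  refine (Finset.sum_le_sum fun x hx => ?_).trans
    (Finset.sum_le_univ_sum_of_nonneg fun x =>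
      mul_nonneg (iidProb_nonneg hp₀.1 x) (sq_nonneg _))
  rcases eq_or_ne (iidProb p₀ x) 0 with hzero | hne
  · simp [hzero]
  · refine mul_le_mul_of_nonneg_left ?_ (iidProb_nonneg hp₀.1 x)
    rw [← sq_abs (∑ j, _)]
    exact pow_le_pow_left₀ hb.le (lt_abs_sum_information_of_notMem_typical hp₀.1 hne
      (Finset.disjoint_left.1 hs hx)).le 2

lemma sum_iidProb_le_of_card_le (hp₀ : p₀ ∈ stdSimplex ℝ α) (hb : 0 < b) {N : ℝ}
    {V : Finset (ι → α)} (hV : (V.card : ℝ) ≤ N) :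
    ∑ v ∈ V, iidProb p₀ v ≤
      N * Real.exp (-(Fintype.card ι * entropy p₀) + b) +
        Fintype.card ι * varentropy p₀ / b ^ 2 := by
  classical
  have htypical : ∑ v ∈ V ∩ typical ι p₀ b, iidProb p₀ v ≤
      N * Real.exp (-(Fintype.card ι * entropy p₀) + b) := by
    refine (Finset.sum_le_card_nsmul _ _ _ fun v hv =>
      (mem_typical.1 (Finset.mem_inter.1 hv).2).2).trans ?_
    rw [nsmul_eq_mul]
    gcongr
    exact (Nat.cast_le.2 (Finset.card_le_card Finset.inter_subset_left)).trans hV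
  rw [← Finset.sum_inter_add_sum_sdiff V (typical ι p₀ b)]
  exact add_le_add htypical (sum_iidProb_le_of_disjoint_typical hp₀ hb Finset.sdiff_disjoint)

lemma le_sum_typical (hp₀ : p₀ ∈ stdSimplex ℝ α) (hb : 0 < b) :
    1 - Fintype.card ι * varentropy p₀ / b ^ 2 ≤ ∑ x ∈ typical ι p₀ b, iidProb p₀ x := by
  classical
  have htotal := Finset.sum_add_sum_compl (typical ι p₀ b) (iidProb p₀)
  rw [sum_iidProb hp₀.2] at htotal
  linarith [sum_iidProb_le_of_disjoint_typical hp₀ hb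
    (disjoint_compl_left (a := typical ι p₀ b))]

lemma one_sub_div_le_sum_typical (hp₀ : p₀ ∈ stdSimplex ℝ α) {n : ℕ} (hn : 0 < n)
    (hι : Fintype.card ι ≤ n) {δ : ℝ} (hδ : 0 < δ) :
    1 - varentropy p₀ / δ ^ 2 / n ≤ ∑ x ∈ typical ι p₀ (δ * n), iidProb p₀ x := by
  refine le_trans ?_ (le_sum_typical hp₀ (by positivity))
  have hV := varentropy_nonneg hp₀.1
  have hcard : (Fintype.card ι : ℝ) ≤ n := by exact_mod_cast hι
  calc 1 - varentropy p₀ / δ ^ 2 / n = 1 - n * varentropy p₀ / (δ * n) ^ 2 := by field_simp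
    _ ≤ 1 - Fintype.card ι * varentropy p₀ / (δ * n) ^ 2 := by gcongr

lemma card_le_exp_of_subset_typical (hp₀ : p₀ ∈ stdSimplex ℝ α) {s : Finset (ι → α)}
    (hs : s ⊆ typical ι p₀ b) :
    (s.card : ℝ) ≤ Real.exp (Fintype.card ι * entropy p₀ + b) := by
  have hmass : (s.card : ℝ) * Real.exp (-(Fintype.card ι * entropy p₀) - b) ≤ 1 := by
    rw [← nsmul_eq_mul]
    exact (Finset.card_nsmul_le_sum _ _ _ fun x hx => (mem_typical.1 (hs hx)).1).trans
      (sum_iidProb_le_one hp₀ s)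
  rwa [← neg_add', Real.exp_neg, ← div_eq_mul_inv, div_le_one (Real.exp_pos _)] at hmass

end Typical

section Restriction

variable {α ι : Type*} [Fintype ι] {p₀ : α → ℝ} (P : ι → Prop) [DecidablePred P]

lemma iidProb_restrict_mul (x : ι → α) :
    iidProb p₀ (Subtype.restrict P x) * iidProb p₀ (Subtype.restrict (fun j => ¬ P j) x) =
      iidProb p₀ x :=
  Fintype.prod_subtype_mul_prod_subtype P fun j => p₀ (x j)

variable [Fintype α] [DecidableEq ι]

lemma sum_iidProb_mul_restrict_mul (f : ({j // P j} → α) → ℝ) (g : ({j // ¬ P j} → α) → ℝ) :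
    ∑ x : ι → α, iidProb p₀ x *
        (f (Subtype.restrict P x) * g (Subtype.restrict (fun j => ¬ P j) x)) =
      (∑ u, iidProb p₀ u * f u) * ∑ v, iidProb p₀ v * g v := by
  rw [Finset.sum_mul_sum, ← Fintype.sum_prod_type',
    ← (Equiv.piEquivPiSubtypeProd P fun _ => α).sum_comp]
  simp only [← iidProb_restrict_mul P, mul_mul_mul_comm]
  rfl

lemma sum_iidProb_restrict_mem [DecidableEq α] (T₁ : Finset ({j // P j} → α))
    (T₂ : Finset ({j // ¬ P j} → α)) :
    ∑ x ∈ Finset.univ.filter fun x : ι → α =>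
        Subtype.restrict (fun j => ¬ P j) x ∈ T₂ ∧ Subtype.restrict P x ∈ T₁, iidProb p₀ x =
      (∑ u ∈ T₁, iidProb p₀ u) * ∑ v ∈ T₂, iidProb p₀ v := by
  have hsplit := sum_iidProb_mul_restrict_mul (p₀ := p₀) P
    (fun u => if u ∈ T₁ then 1 else 0) fun v => if v ∈ T₂ then 1 else 0
  simpa [Finset.sum_filter, ite_and] using hsplit

lemma sum_iidProb_mul_restrict (hp₀ : ∑ a, p₀ a = 1) (f : ({j // P j} → α) → ℝ) :
    ∑ x : ι → α, iidProb p₀ x * f (Subtype.restrict P x) = ∑ u, iidProb p₀ u * f u := by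
  simpa [sum_iidProb hp₀] using sum_iidProb_mul_restrict_mul (p₀ := p₀) P f fun _ => 1

end Restriction

/-! ### Distortion forced on a causal eavesdropper -/

namespace Code

variable {𝒳 𝒵 : Type} [Fintype 𝒳] {n K M m : ℕ} {p₀ : 𝒳 → ℝ}

section JointProb

variable (c : Code 𝒳 n K M)

lemma jointProb_nonneg (hp₀ : ∀ a, 0 ≤ p₀ a) (x : Fin n → 𝒳) (i : Fin M) :
    0 ≤ c.jointProb p₀ x i :=
  mul_nonneg (iidProb_nonneg hp₀ x)
    (Finset.sum_nonneg fun ω _ => mul_nonneg (by positivity) ((c.enc x ω).2.1 i))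

lemma sum_jointProb (hK : 0 < K) (p₀ : 𝒳 → ℝ) (x : Fin n → 𝒳) :
    ∑ i, c.jointProb p₀ x i = iidProb p₀ x := by
  simp only [jointProb]
  rw [← Finset.mul_sum, Finset.sum_comm]
  simp only [← Finset.mul_sum, (c.enc x _).2.2]
  simp [iidProb, hK.ne']

lemma sum_sum_jointProb (hK : 0 < K) (hp₀ : ∑ a, p₀ a = 1) :
    ∑ i, ∑ x, c.jointProb p₀ x i = 1 := by
  rw [Finset.sum_comm]
  simp only [c.sum_jointProb hK, sum_iidProb hp₀]

lemma revealProb_le_one (hK : 0 < K) (hp₀ : p₀ ∈ stdSimplex ℝ 𝒳) (m : ℕ)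
    (r : Fin M → Fin n → 𝒳) : c.revealProb p₀ m r ≤ 1 := by
  rw [← c.sum_sum_jointProb hK hp₀.2, Finset.sum_comm, revealProb, prob]
  refine Finset.sum_le_sum fun x _ => Finset.sum_le_sum fun i _ => ?_
  split_ifs
  · exact le_rfl
  · exact c.jointProb_nonneg hp₀.1 x i

end JointProb

section ForcedDistortion

variable (c : Code 𝒳 n K M) {d : 𝒳 → 𝒵 → ℝ}

lemma expectedDistortion_nonneg (hp₀ : ∀ a, 0 ≤ p₀ a) (hd : ∀ a b, 0 ≤ d a b) (q : Fin n)
    (z : Fin M → (Fin q.val → 𝒳) → 𝒵) : 0 ≤ c.expectedDistortion p₀ d q z :=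
  Finset.sum_nonneg fun x _ => Finset.sum_nonneg fun i _ =>
    mul_nonneg (c.jointProb_nonneg hp₀ x i) (hd _ _)

lemma expectedDistortion_const (hK : 0 < K) (hp₀ : ∑ a, p₀ a = 1) (q : Fin n) (b : 𝒵) :
    c.expectedDistortion p₀ d q (fun _ _ => b) = ∑ a, p₀ a * d a b := by
  simp only [expectedDistortion, ← Finset.sum_mul, c.sum_jointProb hK]
  exact sum_iidProb_mul_apply hp₀ (fun a => d a b) q

lemma forcedDistortion_le [Finite 𝒵] (z : ∀ q : Fin n, Fin M → (Fin q.val → 𝒳) → 𝒵) :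
    c.forcedDistortion p₀ d ≤ (n : ℝ)⁻¹ * ∑ q, c.expectedDistortion p₀ d q (z q) :=
  mul_le_mul_of_nonneg_left (Finset.sum_le_sum fun q _ =>
    ciInf_le (Set.finite_range _).bddBelow (z q)) (by positivity)

variable (p₀ d) in
lemma exists_forcedDistortion_eq [Finite 𝒵] [Nonempty 𝒵] :
    ∃ z : ∀ q : Fin n, Fin M → (Fin q.val → 𝒳) → 𝒵,
      c.forcedDistortion p₀ d = (n : ℝ)⁻¹ * ∑ q, c.expectedDistortion p₀ d q (z q) := by
  choose z hz using fun q : Fin n => exists_eq_ciInf_of_finite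
    (f := fun z : Fin M → (Fin q.val → 𝒳) → 𝒵 => c.expectedDistortion p₀ d q z)
  exact ⟨z, by simp only [forcedDistortion, hz]⟩

end ForcedDistortion

end Code

lemma Code.past_update {𝒳 : Type} {n : ℕ} (x : Fin n → 𝒳) (q : Fin n) (a : 𝒳) :
    past (Function.update x q a) q = past x q :=
  funext fun j => Function.update_of_ne (fun h => j.isLt.ne (congrArg Fin.val h)) _ _

section Blind

variable {𝒳 𝒵 : Type} [Fintype 𝒳] {p₀ : 𝒳 → ℝ} {d : 𝒳 → 𝒵 → ℝ} {n : ℕ}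

/-- The least distortion of an estimate of a single symbol that ignores all observations. -/
def blindDistortion (p₀ : 𝒳 → ℝ) (d : 𝒳 → 𝒵 → ℝ) : ℝ := ⨅ z, ∑ a, p₀ a * d a z

lemma exists_blindDistortion_eq [Finite 𝒵] [Nonempty 𝒵] (p₀ : 𝒳 → ℝ) (d : 𝒳 → 𝒵 → ℝ) :
    ∃ z, ∑ a, p₀ a * d a z = blindDistortion p₀ d :=
  exists_eq_ciInf_of_finite

lemma blindDistortion_nonneg (hp₀ : ∀ a, 0 ≤ p₀ a) (hd : ∀ a b, 0 ≤ d a b) :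
    0 ≤ blindDistortion p₀ d :=
  Real.iInf_nonneg fun _ => Finset.sum_nonneg fun a _ => mul_nonneg (hp₀ a) (hd _ _)

namespace Code

lemma blindDistortion_le_sum_iidProb_mul_past [Finite 𝒵] (hp₀ : p₀ ∈ stdSimplex ℝ 𝒳) (q : Fin n)
    (z : (Fin q.val → 𝒳) → 𝒵) :
    blindDistortion p₀ d ≤ ∑ x : Fin n → 𝒳, iidProb p₀ x * d (x q) (z (past x q)) := by
  rw [← sum_iidProb_resample hp₀.2 q]
  simp only [past_update, Function.update_self]
  calc blindDistortion p₀ d = ∑ x : Fin n → 𝒳, iidProb p₀ x * blindDistortion p₀ d := by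
        rw [← Finset.sum_mul, sum_iidProb hp₀.2, one_mul]
    _ ≤ _ := Finset.sum_le_sum fun x _ => mul_le_mul_of_nonneg_left
        (ciInf_le (Set.finite_range _).bddBelow (z (past x q))) (iidProb_nonneg hp₀.1 x)

lemma forcedDistortion_le_blindDistortion [Finite 𝒵] [Nonempty 𝒵] {K M : ℕ} (c : Code 𝒳 n K M)
    (hn : 0 < n) (hK : 0 < K) (hp₀ : ∑ a, p₀ a = 1) :
    c.forcedDistortion p₀ d ≤ blindDistortion p₀ d := by
  obtain ⟨b, hb⟩ := exists_blindDistortion_eq p₀ d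
  refine (c.forcedDistortion_le fun _ _ _ => b).trans_eq ?_
  have hn' : (n : ℝ) ≠ 0 := by positivity
  simp only [c.expectedDistortion_const hK hp₀, hb, Finset.sum_const, Finset.card_univ,
    Fintype.card_fin, nsmul_eq_mul, inv_mul_cancel_left₀ hn']

end Code

end Blind

section HiddenPrefix

namespace Code

variable {𝒳 𝒵 : Type} [Fintype 𝒳] {n K M m : ℕ} {p₀ : 𝒳 → ℝ} {d : 𝒳 → 𝒵 → ℝ}
  {c : Code 𝒳 n K M}

variable (c) in
lemma prob_source_and_message_eq (A : (Fin n → 𝒳) → Prop) [DecidablePred A]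
    (i : Fin M) :
    c.prob p₀ (fun x i' => A x ∧ i' = i) = ∑ x with A x, c.jointProb p₀ x i := by
  rw [prob, Finset.sum_filter]
  refine Finset.sum_congr rfl fun x _ => ?_
  by_cases hA : A x <;> simp [hA]

variable (c) in
lemma prob_source_eq (hK : 0 < K) (A : (Fin n → 𝒳) → Prop) [DecidablePred A] :
    c.prob p₀ (fun x _ => A x) = ∑ x with A x, iidProb p₀ x := by
  rw [prob, Finset.sum_filter]
  refine Finset.sum_congr rfl fun x _ => ?_
  by_cases hA : A x <;> simp [hA, c.sum_jointProb hK]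

open Classical in
lemma hidesPrefix_iff (hK : 0 < K) : c.HidesPrefix p₀ m ↔ ∀ (u : Fin n → 𝒳) (i : Fin M),
    (∑ x with ∀ j : Fin n, j.val < m → x j = u j, c.jointProb p₀ x i) =
      (∑ x with ∀ j : Fin n, j.val < m → x j = u j, iidProb p₀ x) *
        ∑ x, c.jointProb p₀ x i := by
  have hmessage : ∀ i, c.prob p₀ (fun _ i' => i' = i) = ∑ x, c.jointProb p₀ x i := fun i => by
    simpa using c.prob_source_and_message_eq (p₀ := p₀) (fun _ => True) i
  simp only [HidesPrefix, prob_source_and_message_eq, c.prob_source_eq hK, hmessage]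

lemma HidesPrefix.sum_jointProb_mul (h : c.HidesPrefix p₀ m) (hK : 0 < K)
    {F : (Fin n → 𝒳) → ℝ} (hF : DependsOn F {j : Fin n | j.val < m}) (i : Fin M) :
    ∑ x, c.jointProb p₀ x i * F x = (∑ x, iidProb p₀ x * F x) * ∑ x, c.jointProb p₀ x i := by
  classical
  let π : (Fin n → 𝒳) → {j : Fin n // j.val < m} → 𝒳 := Subtype.restrict _
  rw [← Finset.sum_fiberwise Finset.univ π (fun x => c.jointProb p₀ x i * F x),
    ← Finset.sum_fiberwise Finset.univ π (fun x => iidProb p₀ x * F x), Finset.sum_mul]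
  refine Finset.sum_congr rfl fun v _ => ?_
  obtain hv | ⟨u, hu⟩ := (Finset.univ.filter (π · = v)).eq_empty_or_nonempty
  · simp [hv]
  have hfibre : ∀ x, π x = v ↔ ∀ j : Fin n, j.val < m → x j = u j := fun x => by
    simp [← (Finset.mem_filter.1 hu).2, π, funext_iff]
  have hFu : ∀ g : (Fin n → 𝒳) → ℝ, ∑ x with π x = v, g x * F x = (∑ x with π x = v, g x) * F u :=
    fun g => by
      rw [Finset.sum_mul]
      exact Finset.sum_congr rfl fun x hx =>
        congrArg _ (hF fun j hj => (hfibre x).1 (Finset.mem_filter.1 hx).2 j hj)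
  rw [hFu, hFu]
  simp only [hfibre]
  rw [(hidesPrefix_iff hK).1 h u i, mul_right_comm]

lemma HidesPrefix.blindDistortion_le_expectedDistortion [Finite 𝒵] (h : c.HidesPrefix p₀ m)
    (hK : 0 < K) (hp₀ : p₀ ∈ stdSimplex ℝ 𝒳) {q : Fin n} (hq : q.val < m)
    (z : Fin M → (Fin q.val → 𝒳) → 𝒵) :
    blindDistortion p₀ d ≤ c.expectedDistortion p₀ d q z := by
  have hcausal : ∀ i, DependsOn (fun x : Fin n → 𝒳 => d (x q) (z i (past x q)))
      {j : Fin n | j.val < m} := fun i x y hxy => by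
    have hpast : past x q = past y q := funext fun j => hxy _ (j.isLt.trans hq)
    simp only [hpast, hxy q hq]
  calc blindDistortion p₀ d
      = ∑ i, blindDistortion p₀ d * ∑ x, c.jointProb p₀ x i := by
        rw [← Finset.mul_sum, c.sum_sum_jointProb hK hp₀.2, mul_one]
    _ ≤ ∑ i, ∑ x, c.jointProb p₀ x i * d (x q) (z i (past x q)) := by
        refine Finset.sum_le_sum fun i _ => ?_
        rw [h.sum_jointProb_mul hK (hcausal i)]
        exact mul_le_mul_of_nonneg_right (blindDistortion_le_sum_iidProb_mul_past hp₀ q (z i))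
          (Finset.sum_nonneg fun x _ => c.jointProb_nonneg hp₀.1 x i)
    _ = c.expectedDistortion p₀ d q z := Finset.sum_comm

lemma sum_ite_val_lt (hm : m ≤ n) (B : ℝ) : ∑ q : Fin n, (if q.val < m then B else 0) = m * B := by
  rw [← Finset.sum_filter, Finset.sum_const, nsmul_eq_mul, Fin.card_filter_val_lt, min_eq_right hm]

lemma HidesPrefix.le_forcedDistortion [Finite 𝒵] [Nonempty 𝒵] (h : c.HidesPrefix p₀ m)
    (hm : m ≤ n) (hK : 0 < K) (hp₀ : p₀ ∈ stdSimplex ℝ 𝒳) (hd : ∀ a b, 0 ≤ d a b) :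
    m / n * blindDistortion p₀ d ≤ c.forcedDistortion p₀ d := by
  obtain ⟨z, hz⟩ := c.exists_forcedDistortion_eq p₀ d
  rw [hz, div_eq_inv_mul, mul_assoc, ← sum_ite_val_lt hm]
  refine mul_le_mul_of_nonneg_left (Finset.sum_le_sum fun q _ => ?_) (by positivity)
  split_ifs with hq
  · exact h.blindDistortion_le_expectedDistortion hK hp₀ hq _
  · exact c.expectedDistortion_nonneg hp₀.1 hd q _

lemma PerfectlySecret.forcedDistortion_eq [Finite 𝒵] [Nonempty 𝒵] (h : c.PerfectlySecret p₀)
    (hn : 0 < n) (hK : 0 < K) (hp₀ : p₀ ∈ stdSimplex ℝ 𝒳) :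
    c.forcedDistortion p₀ d = blindDistortion p₀ d := by
  refine le_antisymm (c.forcedDistortion_le_blindDistortion hn hK hp₀.2) ?_
  obtain ⟨z, hz⟩ := c.exists_forcedDistortion_eq p₀ d
  rw [hz, ← inv_mul_cancel_left₀ (by positivity : (n : ℝ) ≠ 0) (blindDistortion p₀ d)]
  refine mul_le_mul_of_nonneg_left ?_ (by positivity)
  rw [← sum_ite_val_lt le_rfl]
  simp only [Fin.is_lt, if_true]
  exact Finset.sum_le_sum fun q _ => h.blindDistortion_le_expectedDistortion hK hp₀ q.2 _

lemma expectedDistortion_le_one_sub_revealProb (hK : 0 < K) (hp₀ : p₀ ∈ stdSimplex ℝ 𝒳)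
    {d : 𝒳 → 𝒳 → ℝ} (hd₀ : ∀ a, d a a = 0) (hd₁ : ∀ a b, d a b ≤ 1) (r : Fin M → Fin n → 𝒳)
    {q : Fin n} (hq : m ≤ q.val) :
    c.expectedDistortion p₀ d q (fun i _ => r i q) ≤ 1 - c.revealProb p₀ m r := by
  rw [← c.sum_sum_jointProb hK hp₀.2, Finset.sum_comm, revealProb, prob, expectedDistortion,
    ← Finset.sum_sub_distrib]
  refine Finset.sum_le_sum fun x _ => ?_
  rw [← Finset.sum_sub_distrib]
  refine Finset.sum_le_sum fun i _ => ?_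
  split_ifs with h
  · simp [hd₀, h q hq]
  · simpa using mul_le_of_le_one_right (c.jointProb_nonneg hp₀.1 x i) (hd₁ _ _)

lemma forcedDistortion_le_of_revealProb (hn : 0 < n) (hK : 0 < K) (hp₀ : p₀ ∈ stdSimplex ℝ 𝒳)
    {d : 𝒳 → 𝒳 → ℝ} (hd₀ : ∀ a, d a a = 0) (hd₁ : ∀ a b, d a b ≤ 1) (hm : m ≤ n)
    (r : Fin M → Fin n → 𝒳) :
    c.forcedDistortion p₀ d ≤ m / n * blindDistortion p₀ d + (1 - c.revealProb p₀ m r) := by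
  classical
  have := nonempty_of_sum_eq_one hp₀.2
  obtain ⟨b, hb⟩ := exists_blindDistortion_eq p₀ d
  let z : ∀ q : Fin n, Fin M → (Fin q.val → 𝒳) → 𝒳 :=
    fun q i _ => if q.val < m then b else r i q
  have hz : ∀ q : Fin n, c.expectedDistortion p₀ d q (z q) ≤
      (if q.val < m then blindDistortion p₀ d else 0) + (1 - c.revealProb p₀ m r) := by
    intro q
    by_cases hq : q.val < m
    · simp only [z, hq, if_true]
      rw [c.expectedDistortion_const hK hp₀.2, hb]
      linarith [c.revealProb_le_one hK hp₀ m r]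
    · simp only [z, hq, if_false, zero_add]
      exact c.expectedDistortion_le_one_sub_revealProb hK hp₀ hd₀ hd₁ r (not_lt.1 hq)
  have hn' : (n : ℝ) ≠ 0 := by positivity
  refine (c.forcedDistortion_le z).trans
    ((mul_le_mul_of_nonneg_left (Finset.sum_le_sum fun q _ => hz q) (by positivity)).trans_eq ?_)
  rw [Finset.sum_add_distrib, sum_ite_val_lt hm, Finset.sum_const, Finset.card_univ,
    Fintype.card_fin, nsmul_eq_mul, mul_add, inv_mul_cancel_left₀ hn', div_eq_inv_mul, mul_assoc]

end Code

end HiddenPrefix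

/-! ### Eavesdroppers with a short list of candidates -/

section Candidates

namespace Code

variable {𝒳 : Type} [Fintype 𝒳] {n K M m : ℕ} {p₀ : 𝒳 → ℝ} (c : Code 𝒳 n K M)

lemma successProb_eq_sum (p₀ : 𝒳 → ℝ) : c.successProb p₀ = ∑ i : Fin M, ∑ ω : Fin K, ∑ x,
    iidProb p₀ x * (K : ℝ)⁻¹ * (c.enc x ω).1 i * (c.dec i ω).1 x := by
  rw [successProb, Finset.sum_comm]
  exact (Finset.sum_congr rfl fun ω _ => Finset.sum_comm).trans Finset.sum_comm

lemma exists_candidates (hp₀ : p₀ ∈ stdSimplex ℝ 𝒳) :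
    ∃ S : Fin M → Finset (Fin n → 𝒳), (∀ i, (S i).card ≤ K) ∧
      c.successProb p₀ ≤ ∑ i, ∑ x ∈ S i, c.jointProb p₀ x i := by
  classical
  have := nonempty_of_sum_eq_one hp₀.2
  let w : Fin M → Fin K → (Fin n → 𝒳) → ℝ := fun i ω x =>
    iidProb p₀ x * (K : ℝ)⁻¹ * (c.enc x ω).1 i
  have hw : ∀ i ω x, 0 ≤ w i ω x := fun i ω x =>
    mul_nonneg (mul_nonneg (iidProb_nonneg hp₀.1 x) (by positivity)) ((c.enc x ω).2.1 i)
  choose likeliest hlikeliest using fun i ω => Finite.exists_max (w i ω)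
  refine ⟨fun i => Finset.univ.image (likeliest i), fun i => by
    simpa using Finset.card_image_le (s := Finset.univ) (f := likeliest i), ?_⟩
  rw [successProb_eq_sum]
  refine Finset.sum_le_sum fun i _ => ?_
  calc ∑ ω, ∑ x, w i ω x * (c.dec i ω).1 x
      ≤ ∑ ω, ∑ x ∈ Finset.univ.image (likeliest i), w i ω x := by
        refine Finset.sum_le_sum fun ω _ => ?_
        calc ∑ x, w i ω x * (c.dec i ω).1 x
            ≤ ∑ x, w i ω (likeliest i ω) * (c.dec i ω).1 x :=
              Finset.sum_le_sum fun x _ =>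
                mul_le_mul_of_nonneg_right (hlikeliest i ω x) ((c.dec i ω).2.1 x)
          _ = w i ω (likeliest i ω) := by rw [← Finset.mul_sum, (c.dec i ω).2.2, mul_one]
          _ ≤ _ := Finset.single_le_sum (f := w i ω) (fun x _ => hw i ω x)
              (Finset.mem_image_of_mem _ (Finset.mem_univ ω))
    _ = ∑ x ∈ Finset.univ.image (likeliest i), c.jointProb p₀ x i := by
        rw [Finset.sum_comm]
        simp only [w, jointProb, iidProb, Finset.mul_sum, mul_assoc]

lemma sum_sum_jointProb_le_one (hK : 0 < K) (hp₀ : p₀ ∈ stdSimplex ℝ 𝒳)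
    (S : Fin M → Finset (Fin n → 𝒳)) : ∑ i, ∑ x ∈ S i, c.jointProb p₀ x i ≤ 1 := by
  rw [← c.sum_sum_jointProb hK hp₀.2]
  exact Finset.sum_le_sum fun i _ =>
    Finset.sum_le_univ_sum_of_nonneg fun x => c.jointProb_nonneg hp₀.1 x i

lemma successProb_le_one (hK : 0 < K) (hp₀ : p₀ ∈ stdSimplex ℝ 𝒳) : c.successProb p₀ ≤ 1 := by
  obtain ⟨S, -, hS⟩ := c.exists_candidates hp₀
  exact hS.trans (c.sum_sum_jointProb_le_one hK hp₀ S)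

variable {c}

lemma HidesPrefix.sum_jointProb_le (h : c.HidesPrefix p₀ m) (hK : 0 < K)
    (hp₀ : p₀ ∈ stdSimplex ℝ 𝒳) [DecidableEq 𝒳] (S : Finset (Fin n → 𝒳)) (i : Fin M) :
    ∑ x ∈ S, c.jointProb p₀ x i ≤
      (∑ v ∈ S.image (Subtype.restrict fun j : Fin n => j.val < m), iidProb p₀ v) *
        ∑ x, c.jointProb p₀ x i := by
  let P : Fin n → Prop := fun j => j.val < m
  let hit : ({j // P j} → 𝒳) → ℝ := fun v => if v ∈ S.image (Subtype.restrict P) then 1 else 0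
  have hit_nonneg : ∀ v, 0 ≤ hit v := fun v => by simp only [hit]; split_ifs <;> simp
  have hdep : DependsOn (fun x : Fin n → 𝒳 => hit (Subtype.restrict P x)) {j : Fin n | j.val < m} :=
    fun x y hxy => congrArg hit (funext fun j => hxy j j.2)
  calc ∑ x ∈ S, c.jointProb p₀ x i
      = ∑ x ∈ S, c.jointProb p₀ x i * hit (Subtype.restrict P x) :=
        Finset.sum_congr rfl fun x hx => by
          rw [show hit _ = 1 from if_pos (Finset.mem_image_of_mem _ hx), mul_one]
    _ ≤ ∑ x, c.jointProb p₀ x i * hit (Subtype.restrict P x) :=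
        Finset.sum_le_univ_sum_of_nonneg fun x =>
          mul_nonneg (c.jointProb_nonneg hp₀.1 x i) (hit_nonneg _)
    _ = (∑ v, iidProb p₀ v * hit v) * ∑ x, c.jointProb p₀ x i := by
        rw [h.sum_jointProb_mul hK hdep, sum_iidProb_mul_restrict P hp₀.2]
    _ = (∑ v ∈ S.image (Subtype.restrict P), iidProb p₀ v) * ∑ x, c.jointProb p₀ x i := by
        simp only [hit, mul_ite, mul_one, mul_zero, Finset.sum_ite_mem, Finset.univ_inter]

lemma HidesPrefix.successProb_le (h : c.HidesPrefix p₀ m) (hm : m ≤ n) (hK : 0 < K)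
    (hp₀ : p₀ ∈ stdSimplex ℝ 𝒳) {b : ℝ} (hb : 0 < b) :
    c.successProb p₀ ≤ K * Real.exp (-(m * entropy p₀) + b) + m * varentropy p₀ / b ^ 2 := by
  classical
  obtain ⟨S, hS, hsuccess⟩ := c.exists_candidates hp₀
  have hcard : Fintype.card {j : Fin n // j.val < m} = m := by
    rw [Fintype.card_subtype, Fin.card_filter_val_lt, min_eq_right hm]
  have hlist : ∀ i, ∑ v ∈ (S i).image (Subtype.restrict fun j : Fin n => j.val < m), iidProb p₀ v ≤
      K * Real.exp (-(m * entropy p₀) + b) + m * varentropy p₀ / b ^ 2 := fun i => by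
    simpa only [hcard] using sum_iidProb_le_of_card_le
      (V := (S i).image (Subtype.restrict fun j : Fin n => j.val < m)) hp₀ hb
      (Nat.cast_le.2 (Finset.card_image_le.trans (hS i)))
  refine hsuccess.trans ((Finset.sum_le_sum fun i _ => (h.sum_jointProb_le hK hp₀ (S i) i).trans
    (mul_le_mul_of_nonneg_right (hlist i)
      (Finset.sum_nonneg fun x _ => c.jointProb_nonneg hp₀.1 x i))).trans_eq ?_)
  rw [← Finset.mul_sum, c.sum_sum_jointProb hK hp₀.2, mul_one]

end Code

end Candidates

section Majority

lemma hamming_nonneg (a b : Bool) : 0 ≤ hamming a b := by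
  unfold hamming; split_ifs <;> norm_num

lemma hamming_self (a : Bool) : hamming a a = 0 := if_pos rfl

lemma hamming_le_one (a b : Bool) : hamming a b ≤ 1 := by
  unfold hamming; split_ifs <;> norm_num

lemma log_four_add_log_add_log_le {c₀ c₁ : ℝ} (h₀ : 0 < c₀) (h₁ : 0 < c₁) :
    Real.log 4 + (Real.log c₀ + Real.log c₁) ≤ 2 * Real.log (c₀ + c₁) := by
  rw [← Real.log_mul h₀.ne' h₁.ne', ← Real.log_mul (by norm_num) (by positivity), two_mul,
    ← Real.log_mul (by positivity) (by positivity)]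
  exact Real.log_le_log (by positivity) (by nlinarith [sq_nonneg (c₀ - c₁)])

lemma min_mul_log_four_le {m₀ m₁ c₀ c₁ : ℝ} (hm₀ : 0 ≤ m₀) (hm₁ : 0 ≤ m₁) (hc₀ : 0 < c₀)
    (hc₁ : 0 < c₁) :
    min m₀ m₁ * Real.log 4 ≤ m₀ * (Real.log (c₀ + c₁) - Real.log c₀) +
      m₁ * (Real.log (c₀ + c₁) - Real.log c₁) := by
  have hgain₀ : 0 ≤ Real.log (c₀ + c₁) - Real.log c₀ :=
    sub_nonneg.2 (Real.log_le_log hc₀ (by linarith))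
  have hgain₁ : 0 ≤ Real.log (c₀ + c₁) - Real.log c₁ :=
    sub_nonneg.2 (Real.log_le_log hc₁ (by linarith))
  calc min m₀ m₁ * Real.log 4
      ≤ min m₀ m₁ * ((Real.log (c₀ + c₁) - Real.log c₀) + (Real.log (c₀ + c₁) - Real.log c₁)) :=
        mul_le_mul_of_nonneg_left (by linarith [log_four_add_log_add_log_le hc₀ hc₁])
          (le_min hm₀ hm₁)
    _ ≤ _ := by
        rw [mul_add]
        gcongr
        · exact min_le_left _ _
        · exact min_le_right _ _

variable {X U : Type*} {μ : X → ℝ}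

lemma exists_majority_bit (hμ : ∀ x, 0 ≤ μ x) (b : X → Bool) (S : Finset X) :
    ∃ z, (∑ x ∈ S, μ x * hamming (b x) z) * Real.log 4 ≤
      ∑ x ∈ S, μ x * (Real.log S.card - Real.log (S.filter fun y => b y = b x).card) := by
  let part : Bool → Finset X := fun β => S.filter fun y => b y = β
  let mass : Bool → ℝ := fun β => ∑ x ∈ part β, μ x
  have hmass : ∀ β, 0 ≤ mass β := fun β => Finset.sum_nonneg fun x _ => hμ x
  have hsplit : ∀ f : Bool → ℝ,
      ∑ x ∈ S, μ x * f (b x) = mass false * f false + mass true * f true := fun f => by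
    rw [← Finset.sum_fiberwise S b, Fintype.sum_bool, add_comm]
    simp only [mass, Finset.sum_mul]
    congr 1 <;> exact Finset.sum_congr rfl fun x hx => by rw [(Finset.mem_filter.1 hx).2]
  refine ⟨decide (mass false ≤ mass true), ?_⟩
  rw [hsplit fun β => hamming β _,
    hsplit fun β => Real.log S.card - Real.log (S.filter fun y => b y = β).card]
  have hloss : mass false * hamming false (decide (mass false ≤ mass true)) +
      mass true * hamming true (decide (mass false ≤ mass true)) =
        min (mass false) (mass true) := by
    rcases le_or_gt (mass false) (mass true) with h | h
    · simp [h, hamming]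
    · simp [h.not_ge, h.le, hamming]
  have hcard : (S.card : ℝ) = (part false).card + (part true).card := by
    rw [add_comm, ← Nat.cast_add, ← Fintype.sum_bool fun β => (part β).card,
      Finset.card_eq_sum_card_fiberwise fun x _ => Finset.mem_univ (b x)]
  have hempty : ∀ β, part β = ∅ → mass β = 0 := fun β h => by simp only [mass, h, Finset.sum_empty]
  rw [hloss, hcard]
  change _ ≤ mass false * (_ - Real.log (part false).card) +
    mass true * (_ - Real.log (part true).card)
  rcases (part false).eq_empty_or_nonempty with h₀ | h₀
  · simp [hempty _ h₀, h₀, hmass true]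
  rcases (part true).eq_empty_or_nonempty with h₁ | h₁
  · simp [hempty _ h₁, h₁, hmass false]
  exact min_mul_log_four_le (hmass _) (hmass _) (Nat.cast_pos.2 h₀.card_pos)
    (Nat.cast_pos.2 h₁.card_pos)

lemma exists_majority_rule [DecidableEq U] (hμ : ∀ x, 0 ≤ μ x) (h : X → U) (b : X → Bool)
    (S : Finset X) :
    ∃ z : U → Bool, (∑ x ∈ S, μ x * hamming (b x) (z (h x))) * Real.log 4 ≤
      ∑ x ∈ S, μ x * (Real.log (S.filter fun y => h y = h x).card -
        Real.log (S.filter fun y => h y = h x ∧ b y = b x).card) := by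
  choose z hz using fun u => exists_majority_bit hμ b (S.filter fun y => h y = u)
  refine ⟨z, ?_⟩
  have hmaps : ∀ x ∈ S, h x ∈ S.image h := fun x hx => Finset.mem_image_of_mem h hx
  rw [← Finset.sum_fiberwise_of_maps_to hmaps fun x => μ x * hamming (b x) (z (h x)),
    ← Finset.sum_fiberwise_of_maps_to hmaps fun x => μ x * (Real.log _ - Real.log _),
    Finset.sum_mul]
  refine Finset.sum_le_sum fun u _ => ?_
  refine (le_of_eq ?_).trans ((hz u).trans_eq ?_)
  · refine congrArg (· * _) (Finset.sum_congr rfl fun x hx => ?_)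
    rw [(Finset.mem_filter.1 hx).2]
  · refine Finset.sum_congr rfl fun x hx => ?_
    rw [(Finset.mem_filter.1 hx).2, Finset.filter_filter]

namespace Code

variable {n K M : ℕ}

/-- The members of the candidate list `S` that agree with `x` before position `q`. -/
def agreeing (S : Finset (Fin n → Bool)) (q : ℕ) (x : Fin n → Bool) : Finset (Fin n → Bool) :=
  S.filter fun y => ∀ j : Fin n, j.val < q → y j = x j

lemma agreeing_val (S : Finset (Fin n → Bool)) (q : Fin n) (x : Fin n → Bool) :
    agreeing S q.val x = S.filter fun y => past y q = past x q :=
  Finset.filter_congr fun _ _ =>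
    ⟨fun h => funext fun j => h _ j.isLt, fun h j hj => congrFun h ⟨j, hj⟩⟩

lemma agreeing_succ (S : Finset (Fin n → Bool)) (q : Fin n) (x : Fin n → Bool) :
    agreeing S (q.val + 1) x = S.filter fun y => past y q = past x q ∧ y q = x q := by
  rw [← Finset.filter_filter, ← agreeing_val, agreeing, agreeing, Finset.filter_filter]
  refine Finset.filter_congr fun y _ => ⟨fun h => ⟨fun j hj => h j (by lia), h q (by lia)⟩, ?_⟩
  rintro ⟨hbefore, hat⟩ j hj
  rcases Nat.lt_succ_iff_lt_or_eq.1 hj with h | h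
  · exact hbefore j h
  · rwa [Fin.ext h]

lemma sum_log_agreeing_le {S : Finset (Fin n → Bool)} {x : Fin n → Bool} (hx : x ∈ S) :
    ∑ q : Fin n, (Real.log (agreeing S q.val x).card - Real.log (agreeing S (q.val + 1) x).card) ≤
      Real.log S.card := by
  rw [Fin.sum_univ_eq_sum_range
    (fun q => Real.log (agreeing S q x).card - Real.log (agreeing S (q + 1) x).card),
    Finset.sum_range_sub']
  have hlast : 1 ≤ (agreeing S n x).card :=
    Finset.card_pos.2 ⟨x, Finset.mem_filter.2 ⟨hx, fun _ _ => rfl⟩⟩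
  have hlog : 0 ≤ Real.log (agreeing S n x).card := Real.log_nonneg (by exact_mod_cast hlast)
  simpa [agreeing] using hlog

lemma exists_causal_majority {μ : (Fin n → Bool) → ℝ} (hμ : ∀ x, 0 ≤ μ x)
    (S : Finset (Fin n → Bool)) :
    ∃ z : ∀ q : Fin n, (Fin q.val → Bool) → Bool,
      (∑ q, ∑ x ∈ S, μ x * hamming (x q) (z q (past x q))) * Real.log 4 ≤
        (∑ x ∈ S, μ x) * Real.log S.card := by
  choose z hz using fun q : Fin n => exists_majority_rule hμ (past · q) (· q) S
  refine ⟨z, ?_⟩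
  rw [Finset.sum_mul, Finset.sum_mul]
  refine (Finset.sum_le_sum fun q _ => hz q).trans ?_
  rw [Finset.sum_comm]
  refine Finset.sum_le_sum fun x hx => ?_
  simp only [← agreeing_val, ← agreeing_succ, ← Finset.mul_sum]
  exact mul_le_mul_of_nonneg_left (sum_log_agreeing_le hx) (hμ x)

lemma expectedDistortion_le_add_sub {𝒳 𝒵 : Type} [Fintype 𝒳] (c : Code 𝒳 n K M) {p₀ : 𝒳 → ℝ}
    (hK : 0 < K) (hp₀ : p₀ ∈ stdSimplex ℝ 𝒳) {d : 𝒳 → 𝒵 → ℝ} (hd : ∀ a b, d a b ≤ 1) (q : Fin n)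
    (z : Fin M → (Fin q.val → 𝒳) → 𝒵) (S : Fin M → Finset (Fin n → 𝒳)) :
    c.expectedDistortion p₀ d q z ≤
      (∑ i, ∑ x ∈ S i, c.jointProb p₀ x i * d (x q) (z i (past x q))) +
        (1 - ∑ i, ∑ x ∈ S i, c.jointProb p₀ x i) := by
  classical
  rw [expectedDistortion, Finset.sum_comm, ← c.sum_sum_jointProb hK hp₀.2,
    ← Finset.sum_sub_distrib, ← Finset.sum_add_distrib]
  refine Finset.sum_le_sum fun i _ => ?_
  rw [← Finset.sum_add_sum_compl (S i),
    ← Finset.sum_add_sum_compl (S i) fun x => c.jointProb p₀ x i, add_sub_cancel_left]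
  gcongr with x
  exact mul_le_of_le_one_right (c.jointProb_nonneg hp₀.1 x i) (hd _ _)

lemma exists_causal_majority_of_card_le (c : Code Bool n K M) {p₀ : Bool → ℝ} (hK : 0 < K)
    (hp₀ : p₀ ∈ stdSimplex ℝ Bool) {S : Fin M → Finset (Fin n → Bool)}
    (hS : ∀ i, (S i).card ≤ K) :
    ∃ z : Fin M → ∀ q : Fin n, (Fin q.val → Bool) → Bool,
      (∑ q, ∑ i, ∑ x ∈ S i, c.jointProb p₀ x i * hamming (x q) (z i q (past x q))) ≤
        Real.log K / Real.log 4 := by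
  have hjoint := c.jointProb_nonneg hp₀.1
  choose z hz using fun i => exists_causal_majority (fun x => hjoint x i) (S i)
  refine ⟨z, ?_⟩
  rw [le_div_iff₀ (Real.log_pos (by norm_num)), Finset.sum_comm, Finset.sum_mul]
  calc _ ≤ ∑ i, (∑ x ∈ S i, c.jointProb p₀ x i) * Real.log K := by
        refine Finset.sum_le_sum fun i _ => (hz i).trans ?_
        rcases (S i).eq_empty_or_nonempty with h | h
        · simp [h]
        exact mul_le_mul_of_nonneg_left
          (Real.log_le_log (Nat.cast_pos.2 h.card_pos) (Nat.cast_le.2 (hS i)))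
          (Finset.sum_nonneg fun x _ => hjoint x i)
    _ ≤ Real.log K := by
        rw [← Finset.sum_mul]
        exact mul_le_of_le_one_left (Real.log_nonneg (by exact_mod_cast hK))
          (c.sum_sum_jointProb_le_one hK hp₀ S)

lemma forcedDistortion_le_log (c : Code Bool n K M) {p₀ : Bool → ℝ} (hn : 0 < n) (hK : 0 < K)
    (hp₀ : p₀ ∈ stdSimplex ℝ Bool) :
    c.forcedDistortion p₀ hamming ≤
      (n : ℝ)⁻¹ * (Real.log K / Real.log 4) + (1 - c.successProb p₀) := by
  obtain ⟨S, hS, hsuccess⟩ := c.exists_candidates hp₀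
  obtain ⟨z, herrors⟩ := c.exists_causal_majority_of_card_le hK hp₀ hS
  set listed : ℝ := ∑ i, ∑ x ∈ S i, c.jointProb p₀ x i
  have hn' : (n : ℝ) ≠ 0 := by positivity
  have hunlisted := fun q =>
    c.expectedDistortion_le_add_sub hK hp₀ hamming_le_one q (fun i => z i q) S
  calc c.forcedDistortion p₀ hamming
      ≤ (n : ℝ)⁻¹ * ∑ q, c.expectedDistortion p₀ hamming q (fun i => z i q) :=
        c.forcedDistortion_le fun q i => z i q
    _ ≤ (n : ℝ)⁻¹ * ∑ q : Fin n, ((∑ i, ∑ x ∈ S i,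
          c.jointProb p₀ x i * hamming (x q) (z i q (past x q))) + (1 - listed)) := by
        gcongr with q
        exact hunlisted q
    _ ≤ (n : ℝ)⁻¹ * (Real.log K / Real.log 4 + n * (1 - c.successProb p₀)) := by
        rw [Finset.sum_add_distrib, Finset.sum_const, Finset.card_univ, Fintype.card_fin,
          nsmul_eq_mul]
        gcongr
    _ = _ := by rw [mul_add, inv_mul_cancel_left₀ hn']

end Code

end Majority

/-! ### One-time pads -/

lemma exists_injOn_of_card_le {α β : Type*} [Fintype β] [Nonempty β] {s : Finset α}
    (hs : s.card ≤ Fintype.card β) : ∃ f : α → β, Set.InjOn f s := by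
  obtain ⟨f, -, hf⟩ := s.finite_toSet.exists_injOn_of_encard_le (t := (Set.univ : Set β))
    (by simpa using hs)
  exact ⟨f, hf⟩

namespace Code

section Deterministic

variable {𝒳 : Type} [Fintype 𝒳] {n K M m : ℕ} {p₀ : 𝒳 → ℝ}

open Classical in
/-- The deterministic code with encoding function `f` and decoding function `g`. -/
def ofFun (f : (Fin n → 𝒳) → Fin K → Fin M) (g : Fin M → Fin K → (Fin n → 𝒳)) :
    Code 𝒳 n K M where
  enc x ω := ⟨fun i => if f x ω = i then 1 else 0, ite_eq_mem_stdSimplex ℝ _⟩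
  dec i ω := ⟨fun x => if g i ω = x then 1 else 0, ite_eq_mem_stdSimplex ℝ _⟩

variable (f : (Fin n → 𝒳) → Fin K → Fin M) (g : Fin M → Fin K → (Fin n → 𝒳))

lemma ofFun_isDeterministic : (ofFun f g).IsDeterministic :=
  ⟨f, g, fun _ _ _ => by simp only [ofFun], fun _ _ _ => by simp only [ofFun]⟩

lemma jointProb_ofFun (p₀ : 𝒳 → ℝ) (x : Fin n → 𝒳) (i : Fin M) :
    (ofFun f g).jointProb p₀ x i = iidProb p₀ x * ((Finset.univ.filter (f x · = i)).card / K) := by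
  simp only [jointProb, ofFun, iidProb, ← Finset.mul_sum, Finset.sum_boole, div_eq_inv_mul]

lemma sum_le_successProb_ofFun (hK : 0 < K) (hp₀ : ∀ a, 0 ≤ p₀ a) {G : Finset (Fin n → 𝒳)}
    (hG : ∀ x ∈ G, ∀ ω, g (f x ω) ω = x) :
    ∑ x ∈ G, iidProb p₀ x ≤ (ofFun f g).successProb p₀ := by
  classical
  have hterm : ∀ (x : Fin n → 𝒳) (ω : Fin K) (i : Fin M),
      0 ≤ iidProb p₀ x * (K : ℝ)⁻¹ * ((ofFun f g).enc x ω).1 i * ((ofFun f g).dec i ω).1 x :=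
    fun x ω i => mul_nonneg (mul_nonneg (mul_nonneg (iidProb_nonneg hp₀ x) (by positivity))
      (((ofFun f g).enc x ω).2.1 i)) (((ofFun f g).dec i ω).2.1 x)
  rw [successProb]
  refine (Finset.sum_le_sum fun x hx => ?_).trans (Finset.sum_le_univ_sum_of_nonneg fun x =>
    Finset.sum_nonneg fun ω _ => Finset.sum_nonneg fun i _ => hterm x ω i)
  calc iidProb p₀ x
      = ∑ ω : Fin K, iidProb p₀ x * (K : ℝ)⁻¹ * ((ofFun f g).enc x ω).1 (f x ω) *
          ((ofFun f g).dec (f x ω) ω).1 x := by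
        simp only [ofFun, hG x hx, if_true, mul_one, Finset.sum_const, Finset.card_univ,
          Fintype.card_fin, nsmul_eq_mul]
        field_simp
    _ ≤ _ := Finset.sum_le_sum fun ω _ =>
        Finset.single_le_sum (f := fun i => iidProb p₀ x * (K : ℝ)⁻¹ *
          ((ofFun f g).enc x ω).1 i * ((ofFun f g).dec i ω).1 x)
          (fun i _ => hterm x ω i) (Finset.mem_univ (f x ω))

lemma hidesPrefix_of_jointProb_eq {c : Code 𝒳 n K M} (hK : 0 < K) (hp₀ : ∑ a, p₀ a = 1)
    (κ : ({j : Fin n // ¬ j.val < m} → 𝒳) → Fin M → ℝ)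
    (h : ∀ x i, c.jointProb p₀ x i = iidProb p₀ x * κ (Subtype.restrict _ x) i) :
    c.HidesPrefix p₀ m := by
  classical
  refine (hidesPrefix_iff hK).2 fun u i => ?_
  let P : Fin n → Prop := fun j => j.val < m
  let F : ({j // P j} → 𝒳) → ℝ := fun v => if v = Subtype.restrict P u then 1 else 0
  have hF : ∀ g : (Fin n → 𝒳) → ℝ, ∑ x with ∀ j : Fin n, j.val < m → x j = u j, g x =
      ∑ x, g x * F (Subtype.restrict P x) := fun g => by
    simp [F, P, funext_iff, Finset.sum_filter]
  calc ∑ x with ∀ j : Fin n, j.val < m → x j = u j, c.jointProb p₀ x i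
      = ∑ x, iidProb p₀ x * (F (Subtype.restrict P x) * κ (Subtype.restrict _ x) i) := by
        simp only [hF, h, mul_assoc, mul_comm (κ _ _)]
    _ = (∑ x, iidProb p₀ x * F (Subtype.restrict P x)) * ∑ x, c.jointProb p₀ x i := by
        have hmessage := sum_iidProb_mul_restrict_mul (p₀ := p₀) P (fun _ => 1) fun v => κ v i
        simp only [one_mul, mul_one, sum_iidProb hp₀] at hmessage
        rw [sum_iidProb_mul_restrict_mul P F fun v => κ v i, sum_iidProb_mul_restrict P hp₀,
          ← hmessage]
        simp only [h, P]
    _ = _ := by rw [hF]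

end Deterministic

section OneTimePad

variable {𝒳 : Type} [Fintype 𝒳] [Nonempty 𝒳] {n K M m : ℕ} {p₀ : 𝒳 → ℝ} {A B : Type*} [AddGroup B]

/-- The code that sends the public part `φ x` and the secret part `ψ x` of the source sequence `x`,
the latter masked by the pad obtained from the key. It decodes the sequences in `G`. -/
def oneTimePad (e : A × B ↪ Fin M) (φ : (Fin n → 𝒳) → A) (ψ : (Fin n → 𝒳) → B) (pad : Fin K → B)
    (G : Finset (Fin n → 𝒳)) : Code 𝒳 n K M :=
  ofFun (fun x ω => e (φ x, ψ x + pad ω))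
    fun i ω => Function.invFunOn (fun x => e (φ x, ψ x + pad ω)) G i

variable {e : A × B ↪ Fin M} {φ : (Fin n → 𝒳) → A} {ψ : (Fin n → 𝒳) → B} {pad : Fin K → B}
  {G : Finset (Fin n → 𝒳)}

lemma sum_le_successProb_oneTimePad (hK : 0 < K) (hp₀ : ∀ a, 0 ≤ p₀ a)
    (hG : Set.InjOn (fun x => (φ x, ψ x)) G) :
    ∑ x ∈ G, iidProb p₀ x ≤ (oneTimePad e φ ψ pad G).successProb p₀ := by
  refine sum_le_successProb_ofFun _ _ hK hp₀ fun x hx ω => ?_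
  refine Set.InjOn.leftInvOn_invFunOn (f := fun x => e (φ x, ψ x + pad ω)) ?_ hx
  intro y hy y' hy' h
  have hparts := e.injective h
  rw [Prod.mk.injEq, add_left_inj] at hparts
  exact hG hy hy' (Prod.ext hparts.1 hparts.2)

lemma jointProb_oneTimePad [DecidableEq A] [DecidableEq B] (p₀ : 𝒳 → ℝ) (x : Fin n → 𝒳) (a : A)
    (b : B) : (oneTimePad e φ ψ pad G).jointProb p₀ x (e (a, b)) =
      if φ x = a then iidProb p₀ x * ((Finset.univ.filter (pad · = -ψ x + b)).card / K) else 0 := by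
  rw [oneTimePad, jointProb_ofFun]
  simp only [e.injective.eq_iff, Prod.mk.injEq, eq_neg_add_iff_add_eq]
  split_ifs with h <;> simp [h]

lemma jointProb_oneTimePad_of_notMem_range (p₀ : 𝒳 → ℝ) (x : Fin n → 𝒳) {i : Fin M}
    (hi : i ∉ Set.range e) : (oneTimePad e φ ψ pad G).jointProb p₀ x i = 0 := by
  have hne : ∀ ω, e (φ x, ψ x + pad ω) ≠ i := fun ω h => hi ⟨_, h⟩
  simp [oneTimePad, jointProb_ofFun, hne]

lemma hidesPrefix_oneTimePad (hK : 0 < K) (hp₀ : ∑ a, p₀ a = 1) (hpad : Function.Bijective pad)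
    (φ : ({j : Fin n // ¬ j.val < m} → 𝒳) → A) :
    (oneTimePad e (fun x => φ (Subtype.restrict _ x)) ψ pad G).HidesPrefix p₀ m := by
  classical
  refine hidesPrefix_of_jointProb_eq hK hp₀
    (fun v i => if ∃ b, e (φ v, b) = i then (K : ℝ)⁻¹ else 0) fun x i => ?_
  by_cases hi : i ∈ Set.range e
  · obtain ⟨⟨a, b⟩, rfl⟩ := hi
    obtain ⟨ω, hω⟩ := hpad.2 (-ψ x + b)
    have hkey : (Finset.univ.filter (pad · = -ψ x + b)).card = 1 :=
      Finset.card_eq_one.2 ⟨ω, by simp [Finset.ext_iff, ← hω, hpad.1.eq_iff]⟩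
    rw [jointProb_oneTimePad, hkey]
    simp
  · rw [jointProb_oneTimePad_of_notMem_range _ _ hi,
      if_neg fun ⟨b, hb⟩ => hi ⟨(φ (Subtype.restrict _ x), b), hb⟩, mul_zero]

end OneTimePad

section HiddenPrefixCodes

variable {𝒳 : Type} [Fintype 𝒳] {n K M m : ℕ} {p₀ : 𝒳 → ℝ}

lemma exists_perfectlySecret (n : ℕ) (hK : 0 < K) (hM : 0 < M) (hp₀ : ∑ a, p₀ a = 1) :
    ∃ c : Code 𝒳 n K M, c.IsDeterministic ∧ c.PerfectlySecret p₀ := by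
  have := nonempty_of_sum_eq_one hp₀
  let f : (Fin n → 𝒳) → Fin K → Fin M := fun _ _ => ⟨0, hM⟩
  exact ⟨_, ofFun_isDeterministic f fun _ _ => Classical.arbitrary _,
    hidesPrefix_of_jointProb_eq hK hp₀
      (fun _ i => (Finset.univ.filter (f (Classical.arbitrary _) · = i)).card / K)
      (jointProb_ofFun f _ p₀)⟩

lemma sum_le_revealProb {c : Code 𝒳 n K M} (hK : 0 < K) (hp₀ : p₀ ∈ stdSimplex ℝ 𝒳)
    {T : Finset ({j : Fin n // ¬ j.val < m} → 𝒳)} {r : Fin M → Fin n → 𝒳}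
    (hr : ∀ x : Fin n → 𝒳, Subtype.restrict (fun j : Fin n => ¬ j.val < m) x ∈ T →
      ∀ i, c.jointProb p₀ x i ≠ 0 → ∀ j : Fin n, m ≤ j.val → r i j = x j) :
    ∑ v ∈ T, iidProb p₀ v ≤ c.revealProb p₀ m r := by
  classical
  have hsuffix := sum_iidProb_mul_restrict (fun j : Fin n => ¬ j.val < m) hp₀.2
    fun v => if v ∈ T then 1 else 0
  simp only [mul_ite, mul_one, mul_zero, Finset.sum_ite_mem, Finset.univ_inter] at hsuffix
  rw [← hsuffix, revealProb, prob]
  refine Finset.sum_le_sum fun x _ => ?_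
  have hnonneg := c.jointProb_nonneg hp₀.1 x
  split_ifs with hx
  · rw [← c.sum_jointProb hK]
    refine Finset.sum_le_sum fun i _ => ?_
    by_cases hi : c.jointProb p₀ x i = 0
    · simp [hi]
    · rw [if_pos (hr x hx i hi)]
  · exact Finset.sum_nonneg fun i _ => by split_ifs <;> simp [hnonneg]

lemma exists_hidesPrefix_of_card_le (hp₀ : p₀ ∈ stdSimplex ℝ 𝒳) {N : ℕ} (hK : 0 < K) (hN : 0 < N)
    (hM : N * K ≤ M) {T₁ : Finset ({j : Fin n // j.val < m} → 𝒳)} (hT₁ : T₁.card ≤ K)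
    {T₂ : Finset ({j : Fin n // ¬ j.val < m} → 𝒳)} (hT₂ : T₂.card ≤ N) :
    ∃ (c : Code 𝒳 n K M) (r : Fin M → Fin n → 𝒳), c.IsDeterministic ∧ c.HidesPrefix p₀ m ∧
      ∑ v ∈ T₂, iidProb p₀ v ≤ c.revealProb p₀ m r ∧
      (∑ u ∈ T₁, iidProb p₀ u) * ∑ v ∈ T₂, iidProb p₀ v ≤ c.successProb p₀ := by
  classical
  have := nonempty_of_sum_eq_one hp₀.2
  have : NeZero K := ⟨hK.ne'⟩
  have : NeZero N := ⟨hN.ne'⟩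
  let P : Fin n → Prop := fun j => j.val < m
  obtain ⟨ψ, hψ⟩ := exists_injOn_of_card_le (β := Fin K) (by simpa using hT₁)
  obtain ⟨φ, hφ⟩ := exists_injOn_of_card_le (β := Fin N) (by simpa using hT₂)
  let e : Fin N × Fin K ↪ Fin M := finProdFinEquiv.toEmbedding.trans (Fin.castLEEmb hM)
  let G : Finset (Fin n → 𝒳) := Finset.univ.filter fun x =>
    Subtype.restrict (fun j => ¬ P j) x ∈ T₂ ∧ Subtype.restrict P x ∈ T₁
  let c : Code 𝒳 n K M :=
    oneTimePad e (fun x => φ (Subtype.restrict _ x)) (fun x => ψ (Subtype.restrict P x)) id G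
  let r : Fin M → Fin n → 𝒳 := fun i j => if hj : ¬ j.val < m then
    Function.invFunOn φ T₂ (Function.invFun e i).1 ⟨j, hj⟩ else Classical.arbitrary 𝒳
  refine ⟨c, r, ofFun_isDeterministic _ _,
    hidesPrefix_oneTimePad hK hp₀.2 Function.bijective_id φ,
    sum_le_revealProb hK hp₀ fun x hx i hi j hj => ?_, ?_⟩
  · obtain ⟨⟨a, b⟩, rfl⟩ : i ∈ Set.range e :=
      not_not.1 fun h => hi (jointProb_oneTimePad_of_notMem_range _ _ h)
    obtain rfl : φ (Subtype.restrict _ x) = a :=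
      not_not.1 fun h => hi ((jointProb_oneTimePad _ _ _ _).trans (if_neg h))
    simp only [r, not_lt.2 hj, not_false_eq_true, dif_pos,
      Function.leftInverse_invFun e.injective (_, b), hφ.leftInvOn_invFunOn hx]
    rfl
  · rw [← sum_iidProb_restrict_mem P T₁ T₂]
    refine sum_le_successProb_oneTimePad hK hp₀.1 fun x hx y hy hxy => ?_
    simp only [Finset.coe_filter, Finset.mem_univ, true_and, Set.mem_ofPred_eq] at hx hy
    obtain ⟨hsuffix, hprefix⟩ := Prod.mk.inj hxy
    exact (Equiv.piEquivPiSubtypeProd P fun _ => 𝒳).injective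
      (Prod.ext (hψ hx.2 hy.2 hprefix) (hφ hx.1 hy.1 hsuffix))

end HiddenPrefixCodes

end Code

/-! ### Covering the cube by subcubes -/

section Covering

variable {X Y : Type*} {r : Y → X → Prop} {S : Finset X} {𝓐 : Finset Y} {θ : ℝ}

open Classical in
lemma exists_card_uncovered_le
    (h : ∀ U ⊆ S, ∃ y ∈ 𝓐, θ * U.card ≤ (U.filter (r y)).card) (t : ℕ) :
    ∃ 𝒞 ⊆ 𝓐, 𝒞.card ≤ t ∧
      ((S.filter fun x => ∀ y ∈ 𝒞, ¬ r y x).card : ℝ) ≤ Real.exp (-θ * t) * S.card := by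
  induction t with
  | zero => exact ⟨∅, by simp⟩
  | succ t ih =>
    obtain ⟨𝒞, h𝒞, hcard, huncovered⟩ := ih
    let U := S.filter fun x => ∀ y ∈ 𝒞, ¬ r y x
    obtain ⟨y, hy, hgain⟩ := h U (Finset.filter_subset _ _)
    refine ⟨insert y 𝒞, Finset.insert_subset hy h𝒞, (Finset.card_insert_le _ _).trans (by lia), ?_⟩
    have hinsert : (S.filter fun x => ∀ y' ∈ insert y 𝒞, ¬ r y' x) = U.filter (¬ r y ·) := by
      ext x
      simp only [U, Finset.forall_mem_insert, Finset.mem_filter]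
      tauto
    have hpartition : ((U.filter (r y)).card : ℝ) + (U.filter (¬ r y ·)).card = U.card := by
      exact_mod_cast Finset.card_filter_add_card_filter_not (s := U) (r y)
    calc ((S.filter fun x => ∀ y' ∈ insert y 𝒞, ¬ r y' x).card : ℝ)
        ≤ (1 - θ) * U.card := by rw [hinsert]; linarith
      _ ≤ Real.exp (-θ) * (Real.exp (-θ * t) * S.card) :=
          mul_le_mul (Real.one_sub_le_exp_neg θ) huncovered (Nat.cast_nonneg _) (Real.exp_nonneg _)
      _ = Real.exp (-θ * (t + 1 : ℕ)) * S.card := by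
          rw [← mul_assoc, ← Real.exp_add]
          push_cast
          ring_nf

open Classical in
lemma exists_cover_card_le (hθ : 0 < θ)
    (h : ∀ U ⊆ S, ∃ y ∈ 𝓐, θ * U.card ≤ (U.filter (r y)).card) :
    ∃ 𝒞 ⊆ 𝓐, (𝒞.card : ℝ) ≤ Real.log S.card / θ + 1 ∧ ∀ x ∈ S, ∃ y ∈ 𝒞, r y x := by
  obtain rfl | hS := S.eq_empty_or_nonempty
  · exact ⟨∅, by simp⟩
  have hlog : 0 ≤ Real.log S.card := Real.log_natCast_nonneg _
  let t := ⌊Real.log S.card / θ⌋₊ + 1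
  obtain ⟨𝒞, h𝒞, hcard, huncovered⟩ := exists_card_uncovered_le h t
  refine ⟨𝒞, h𝒞, ?_, fun x hx => ?_⟩
  · have hfloor := Nat.floor_le (div_nonneg hlog hθ.le)
    have : (𝒞.card : ℝ) ≤ t := mod_cast hcard
    push_cast [t] at this
    linarith
  · have hsmall : Real.exp (-θ * t) * S.card < 1 := by
      have ht : Real.log S.card < t * θ := (div_lt_iff₀ hθ).1 (mod_cast Nat.lt_floor_add_one _)
      calc Real.exp (-θ * t) * S.card = Real.exp (Real.log S.card - t * θ) := by
            rw [Real.exp_sub, Real.exp_log (mod_cast hS.card_pos), ← mul_comm θ, neg_mul,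
              Real.exp_neg, inv_mul_eq_div]
        _ < 1 := Real.exp_lt_one_iff.2 (by linarith)
    have hempty : (S.filter fun x => ∀ y ∈ 𝒞, ¬ r y x) = ∅ :=
      Finset.card_eq_zero.1 (Nat.lt_one_iff.1 (mod_cast huncovered.trans_lt hsmall))
    by_contra! hx'
    exact Finset.eq_empty_iff_forall_notMem.1 hempty x (Finset.mem_filter.2 ⟨hx, hx'⟩)

open Classical in
lemma exists_mul_card_le_of_regular {k d : ℕ} (h𝓐 : 𝓐.Nonempty)
    (hk : ∀ y ∈ 𝓐, k ≤ (S.filter (r y)).card)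
    (hd : ∀ x ∈ S, (𝓐.filter (r · x)).card = d) {U : Finset X} (hU : U ⊆ S) :
    ∃ y ∈ 𝓐, k * U.card ≤ S.card * (U.filter (r y)).card := by
  refine Finset.exists_le_of_sum_le h𝓐 ?_
  have hdouble : ∀ V ⊆ S, ∑ y ∈ 𝓐, (V.filter (r y)).card = V.card * d := fun V hV => by
    calc ∑ y ∈ 𝓐, (V.filter (r y)).card = ∑ x ∈ V, (𝓐.filter (r · x)).card :=
          Finset.sum_card_bipartiteAbove_eq_sum_card_bipartiteBelow r
      _ = V.card * d := Finset.sum_const_nat fun x hx => hd x (hV hx)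
  calc ∑ _y ∈ 𝓐, k * U.card ≤ ∑ y ∈ 𝓐, (S.filter (r y)).card * U.card :=
        Finset.sum_le_sum fun y hy => Nat.mul_le_mul_right _ (hk y hy)
    _ = ∑ y ∈ 𝓐, S.card * (U.filter (r y)).card := by
        rw [← Finset.sum_mul, ← Finset.mul_sum, hdouble S subset_rfl, hdouble U hU]
        ring

open Classical in
lemma exists_cover_of_regular {k d : ℕ} (h𝓐 : 𝓐.Nonempty) (hk₀ : 0 < k)
    (hk : ∀ y ∈ 𝓐, k ≤ (S.filter (r y)).card) (hd : ∀ x ∈ S, (𝓐.filter (r · x)).card = d) :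
    ∃ 𝒞 ⊆ 𝓐, (𝒞.card * k : ℝ) ≤ S.card * Real.log S.card + k ∧ ∀ x ∈ S, ∃ y ∈ 𝒞, r y x := by
  obtain ⟨y₀, hy₀⟩ := h𝓐
  have hS : 0 < (S.card : ℝ) :=
    mod_cast (hk₀.trans_le (hk y₀ hy₀)).trans_le (Finset.card_le_card (Finset.filter_subset _ _))
  have hk₀ : 0 < (k : ℝ) := mod_cast hk₀
  obtain ⟨𝒞, h𝒞, hcard, hcover⟩ := exists_cover_card_le (r := r) (div_pos hk₀ hS) fun U hU => by
    obtain ⟨y, hy, hgain⟩ := exists_mul_card_le_of_regular ⟨y₀, hy₀⟩ hk hd hU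
    refine ⟨y, hy, ?_⟩
    rw [div_mul_eq_mul_div, div_le_iff₀' hS]
    exact_mod_cast hgain
  refine ⟨𝒞, h𝒞, ?_, hcover⟩
  calc (𝒞.card * k : ℝ) ≤ (Real.log S.card / (k / S.card) + 1) * k := by gcongr
    _ = S.card * Real.log S.card + k := by field_simp

end Covering

section Cube

variable {ι : Type*} [Fintype ι]

/-- The number of ones in a binary sequence. -/
def weight (x : ι → Bool) : ℕ := (Finset.univ.filter fun j => x j = true).card

lemma weight_comp_equiv (x : ι → Bool) (σ : Equiv.Perm ι) : weight (x ∘ σ) = weight x := by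
  rw [weight, weight, ← Finset.card_map σ.toEmbedding]
  congr 1
  ext j
  simp [Finset.mem_map_equiv]

lemma exists_perm_of_weight_eq {x y : ι → Bool} (h : weight x = weight y) :
    ∃ σ : Equiv.Perm ι, y = x ∘ σ := by
  classical
  let e : {j // y j = true} ≃ {j // x j = true} :=
    Fintype.equivOfCardEq (by simpa [weight, Fintype.card_subtype] using h.symm)
  refine ⟨e.extendSubtype, funext fun j => ?_⟩
  by_cases hj : y j = true
  · simp [hj, e.extendSubtype_mem j hj]
  · simp [Bool.eq_false_iff.2 hj, Bool.eq_false_iff.2 (e.extendSubtype_not_mem j hj)]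

lemma exists_between_weight_eq {x y : ι → Bool} (hxy : x ≤ y) {k : ℕ} (hx : weight x ≤ k)
    (hy : k ≤ weight y) : ∃ a, x ≤ a ∧ a ≤ y ∧ weight a = k := by
  classical
  obtain ⟨s, hxs, hsy, hcard⟩ := Finset.exists_subsuperset_card_eq
    (Finset.monotone_filter_right Finset.univ fun j _ (hj : x j = true) => hxy j hj) hx hy
  refine ⟨fun j => decide (j ∈ s), fun j hj => ?_, fun j hj => ?_, by simpa [weight] using hcard⟩
  · simpa using hxs (Finset.mem_filter.2 ⟨Finset.mem_univ j, hj⟩)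
  · exact (Finset.mem_filter.1 (hsy (of_decide_eq_true hj))).2

lemma weight_add_hammingDist {a b : ι → Bool} (h : a ≤ b) :
    weight a + hammingDist a b = weight b := by
  classical
  have hpointwise : ∀ j, a j = true → b j = true := fun j => h j
  rw [weight, weight, hammingDist, ← Finset.card_union_of_disjoint]
  · congr 1
    ext j
    have := hpointwise j
    cases ha : a j <;> cases hb : b j <;> simp_all
  · exact Finset.disjoint_filter.2 fun j _ hj hne => hne (hj.trans (hpointwise j hj).symm)

lemma weight_le_card (x : ι → Bool) : weight x ≤ Fintype.card ι := Finset.card_le_univ _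

open Classical in
lemma choose_le_card_weight_eq {a b : ι → Bool} (h : a ≤ b) (k : ℕ) :
    (hammingDist a b).choose k ≤
      (Finset.univ.filter fun x => weight x = weight a + k ∧ x ∈ Set.Icc a b).card := by
  have hpointwise : ∀ j, a j = true → b j = true := fun j => h j
  let fill : Finset ι → ι → Bool := fun t j => a j || decide (j ∈ t)
  have hfilled : ∀ t ∈ (Finset.univ.filter fun j => a j ≠ b j).powersetCard k,
      (Finset.univ.filter fun j => a j ≠ fill t j) = t := fun t ht => by
    ext j
    have hfree : j ∈ t → a j ≠ b j := fun hj =>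
      (Finset.mem_filter.1 ((Finset.mem_powersetCard.1 ht).1 hj)).2
    have := hpointwise j
    cases ha : a j <;> simp_all [fill]
  rw [hammingDist, ← Finset.card_powersetCard]
  refine Finset.card_le_card_of_injOn fill (fun t ht => ?_) fun t ht t' ht' heq => ?_
  · obtain ⟨htD, htk⟩ := Finset.mem_powersetCard.1 (Finset.mem_coe.1 ht)
    have hle : a ≤ fill t := fun j hj => by simp [fill, hj]
    have hge : fill t ≤ b := fun j hj => by
      rcases Bool.or_eq_true_iff.1 hj with hj | hj
      · exact hpointwise j hj
      · have hne := (Finset.mem_filter.1 (htD (of_decide_eq_true hj))).2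
        cases ha : a j <;> simp_all
    refine Finset.mem_coe.2 (Finset.mem_filter.2 ⟨Finset.mem_univ _, ?_, hle, hge⟩)
    rw [← weight_add_hammingDist hle, hammingDist, hfilled t ht, htk]
  · rw [← hfilled t ht, ← hfilled t' ht', heq]

open Classical in
/-- The subcubes of dimension `2 * l` centred at weight `w`. A subcube is encoded by its least and
its greatest element. -/
def centredCubes (ι : Type*) [Fintype ι] (w l : ℕ) : Finset ((ι → Bool) × (ι → Bool)) :=
  Finset.univ.filter fun u => u.1 ≤ u.2 ∧ weight u.1 + l = w ∧ weight u.2 = w + l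

lemma mem_centredCubes {w l : ℕ} {u : (ι → Bool) × (ι → Bool)} :
    u ∈ centredCubes ι w l ↔ u.1 ≤ u.2 ∧ weight u.1 + l = w ∧ weight u.2 = w + l := by
  simp [centredCubes]

lemma hammingDist_of_mem_centredCubes {w l : ℕ} {u : (ι → Bool) × (ι → Bool)}
    (hu : u ∈ centredCubes ι w l) : hammingDist u.1 u.2 = 2 * l := by
  obtain ⟨hle, ha, hb⟩ := mem_centredCubes.1 hu
  have := weight_add_hammingDist hle
  lia

lemma centredCubes_nonempty {w l : ℕ} (hl : l ≤ w) (hw : w + l ≤ Fintype.card ι) :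
    (centredCubes ι w l).Nonempty := by
  have hbot : weight (fun _ : ι => false) = 0 := by simp [weight]
  have htop : weight (fun _ : ι => true) = Fintype.card ι := by simp [weight]
  obtain ⟨b, -, -, hb⟩ := exists_between_weight_eq (x := fun _ : ι => false) (y := fun _ => true)
    (fun _ => Bool.false_le _) (by lia) (hw.trans htop.ge)
  obtain ⟨a, -, hab, ha⟩ := exists_between_weight_eq (x := fun _ : ι => false) (y := b)
    (k := w - l) (fun _ => Bool.false_le _) (by lia) (by lia)
  exact ⟨(a, b), mem_centredCubes.2 ⟨hab, by lia, hb⟩⟩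

open Classical in
lemma card_centredCubes_filter_mem_eq {x y : ι → Bool} (h : weight x = weight y) (w l : ℕ) :
    ((centredCubes ι w l).filter fun u => x ∈ Set.Icc u.1 u.2).card =
      ((centredCubes ι w l).filter fun u => y ∈ Set.Icc u.1 u.2).card := by
  suffices hle : ∀ x y : ι → Bool, weight x = weight y →
      ((centredCubes ι w l).filter fun u => x ∈ Set.Icc u.1 u.2).card ≤
        ((centredCubes ι w l).filter fun u => y ∈ Set.Icc u.1 u.2).card from
    (hle x y h).antisymm (hle y x h.symm)
  intro x y hxy
  obtain ⟨σ, rfl⟩ := exists_perm_of_weight_eq hxy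
  refine Finset.card_le_card_of_injOn (Prod.map (· ∘ σ) (· ∘ σ)) (fun u hu => ?_)
    (Function.Injective.injOn ?_)
  · obtain ⟨hu, hx⟩ := Finset.mem_filter.1 (Finset.mem_coe.1 hu)
    obtain ⟨hle, ha, hb⟩ := mem_centredCubes.1 hu
    exact Finset.mem_coe.2 (Finset.mem_filter.2 ⟨mem_centredCubes.2
      ⟨fun j => hle (σ j), by simpa [weight_comp_equiv] using ha,
        by simpa [weight_comp_equiv] using hb⟩, fun j => hx.1 (σ j), fun j => hx.2 (σ j)⟩)
  · exact (σ.surjective.injective_comp_right).prodMap σ.surjective.injective_comp_right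

lemma log_card_le (S : Finset (ι → Bool)) : Real.log S.card ≤ Fintype.card ι := by
  classical
  rcases S.card.eq_zero_or_pos with hS | hS
  · simp [hS]
  have hcard : S.card ≤ 2 ^ Fintype.card ι := by simpa using S.card_le_univ
  calc Real.log S.card ≤ Real.log (2 ^ Fintype.card ι) :=
        Real.log_le_log (mod_cast hS) (mod_cast hcard)
    _ ≤ Fintype.card ι * 1 := by
        rw [Real.log_pow]
        gcongr
        linarith [Real.log_two_lt_d9]
    _ = Fintype.card ι := mul_one _

lemma exists_cover_weight_eq {w l : ℕ} (hl : l ≤ w) (hw : w + l ≤ Fintype.card ι)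
    {S : Finset (ι → Bool)} (hS : ∀ x, x ∈ S ↔ weight x = w) :
    ∃ 𝒞 ⊆ centredCubes ι w l,
      (𝒞.card * 4 ^ l : ℝ) ≤ Fintype.card ι * (2 * l + 1) * S.card + 4 ^ l ∧
      ∀ x, weight x = w → ∃ u ∈ 𝒞, x ∈ Set.Icc u.1 u.2 := by
  classical
  have hchoose : 0 < (2 * l).choose l := Nat.choose_pos (by lia)
  have hcontains : ∀ u ∈ centredCubes ι w l,
      (2 * l).choose l ≤ (S.filter fun x => x ∈ Set.Icc u.1 u.2).card := fun u hu => by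
    have hle := choose_le_card_weight_eq (mem_centredCubes.1 hu).1 l
    rw [hammingDist_of_mem_centredCubes hu, (mem_centredCubes.1 hu).2.1] at hle
    refine hle.trans_eq (congrArg _ ?_)
    ext x
    simp [hS]
  obtain ⟨x₀, hx₀⟩ : S.Nonempty := by
    obtain ⟨u, hu⟩ := centredCubes_nonempty hl hw
    exact (Finset.card_pos.1 (hchoose.trans_le (hcontains u hu))).mono (Finset.filter_subset _ _)
  obtain ⟨𝒞, h𝒞, hcard, hcover⟩ := exists_cover_of_regular (r := fun u x => x ∈ Set.Icc u.1 u.2)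
    (d := ((centredCubes ι w l).filter fun u => x₀ ∈ Set.Icc u.1 u.2).card)
    (centredCubes_nonempty hl hw) hchoose (by simpa using hcontains) fun x hx => by
      simpa using
        card_centredCubes_filter_mem_eq (((hS x).1 hx).trans ((hS x₀).1 hx₀).symm) w l
  refine ⟨𝒞, h𝒞, ?_, fun x hx => hcover x ((hS x).2 hx)⟩
  have hfour : (4 : ℝ) ^ l ≤ (2 * l + 1) * (2 * l).choose l :=
    mod_cast Nat.four_pow_le_two_mul_add_one_mul_central_binom l
  have hexcess : ((𝒞.card : ℝ) - 1) * (2 * l).choose l ≤ S.card * Fintype.card ι := by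
    nlinarith [log_card_le S]
  obtain h𝒞 | h𝒞 := 𝒞.card.eq_zero_or_pos
  · rw [h𝒞, Nat.cast_zero, zero_mul]
    positivity
  have h𝒞 : (0 : ℝ) ≤ 𝒞.card - 1 := sub_nonneg.2 (mod_cast h𝒞)
  calc (𝒞.card * 4 ^ l : ℝ) = (𝒞.card - 1) * 4 ^ l + 4 ^ l := by ring
    _ ≤ (𝒞.card - 1) * ((2 * l + 1) * (2 * l).choose l) + 4 ^ l := by gcongr
    _ = (2 * l + 1) * ((𝒞.card - 1) * (2 * l).choose l) + 4 ^ l := by ring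
    _ ≤ (2 * l + 1) * (S.card * Fintype.card ι) + 4 ^ l := by gcongr
    _ = Fintype.card ι * (2 * l + 1) * S.card + 4 ^ l := by ring

lemma exists_cover_filter_weight_eq {T : Finset (ι → Bool)}
    (hT : ∀ x ∈ T, ∀ y, weight y = weight x → y ∈ T) {l : ℕ}
    (hl : ∀ x ∈ T, l ≤ weight x ∧ weight x + l ≤ Fintype.card ι) (w : ℕ) :
    ∃ 𝒞 : Finset ((ι → Bool) × (ι → Bool)), 𝒞 ⊆ centredCubes ι w l ∧
      (𝒞.card * 4 ^ l : ℝ) ≤ Fintype.card ι * (2 * l + 1) * T.card + 4 ^ l ∧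
      ∀ x ∈ T, weight x = w → ∃ u ∈ 𝒞, x ∈ Set.Icc u.1 u.2 := by
  classical
  by_cases hw : ∃ x ∈ T, weight x = w
  · obtain ⟨x₀, hx₀, rfl⟩ := hw
    obtain ⟨𝒞, h𝒞, hcard, hcover⟩ := exists_cover_weight_eq (hl x₀ hx₀).1 (hl x₀ hx₀).2
      (S := T.filter fun x => weight x = weight x₀) fun x => by
        simpa using fun h => hT x₀ hx₀ x h
    refine ⟨𝒞, h𝒞, hcard.trans ?_, fun x _ hx => hcover x hx⟩
    gcongr
    exact Finset.filter_subset _ _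
  · exact ⟨∅, by simp, by simpa using by positivity, fun x hx h => (hw ⟨x, hx, h⟩).elim⟩

lemma exists_cube_cover {T : Finset (ι → Bool)} (hT : ∀ x ∈ T, ∀ y, weight y = weight x → y ∈ T)
    {l : ℕ} (hl : ∀ x ∈ T, l ≤ weight x ∧ weight x + l ≤ Fintype.card ι) :
    ∃ 𝒞 : Finset ((ι → Bool) × (ι → Bool)),
      (𝒞.card * 4 ^ l : ℝ) ≤ (Fintype.card ι + 1) *
        (Fintype.card ι * (2 * l + 1) * T.card + 4 ^ l) ∧
      (∀ u ∈ 𝒞, hammingDist u.1 u.2 = 2 * l) ∧ ∀ x ∈ T, ∃ u ∈ 𝒞, x ∈ Set.Icc u.1 u.2 := by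
  classical
  choose 𝒞 h𝒞 hcard hcover using exists_cover_filter_weight_eq hT hl
  refine ⟨(Finset.range (Fintype.card ι + 1)).biUnion 𝒞, ?_, fun u hu => ?_, fun x hx => ?_⟩
  · calc (((Finset.range (Fintype.card ι + 1)).biUnion 𝒞).card * 4 ^ l : ℝ)
        ≤ ∑ w ∈ Finset.range (Fintype.card ι + 1), ((𝒞 w).card * 4 ^ l : ℝ) := by
          rw [← Finset.sum_mul]
          gcongr
          exact_mod_cast Finset.card_biUnion_le
      _ ≤ ∑ _w ∈ Finset.range (Fintype.card ι + 1), _ := Finset.sum_le_sum fun w _ => hcard w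
      _ = _ := by rw [Finset.sum_const, Finset.card_range, nsmul_eq_mul, Nat.cast_add_one]
  · obtain ⟨w, -, hu⟩ := Finset.mem_biUnion.1 hu
    exact hammingDist_of_mem_centredCubes (h𝒞 w hu)
  · obtain ⟨u, hu, hxu⟩ := hcover _ x hx rfl
    exact ⟨u, Finset.mem_biUnion.2
      ⟨_, Finset.mem_range.2 (Nat.lt_succ_of_le (weight_le_card x)), hu⟩, hxu⟩

end Cube

/-! ### Causal prediction inside a subcube -/

section Prediction

variable {n : ℕ}

/-- The positions at which the causal predictor `z` of the bit sequence `x` errs. -/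
def mispredictions (z : ∀ q : Fin n, (Fin q.val → Bool) → Bool) (x : Fin n → Bool) :
    Finset (Fin n) :=
  Finset.univ.filter fun q => x q ≠ z q (Code.past x q)

lemma injOn_mispredictions_inter (z : ∀ q : Fin n, (Fin q.val → Bool) → Bool) (a b : Fin n → Bool) :
    Set.InjOn (fun x => mispredictions z x ∩ Finset.univ.filter fun j => a j ≠ b j)
      (Set.Icc a b) := by
  intro x hx y hy hxy
  suffices h : ∀ k : ℕ, ∀ q : Fin n, q.val = k → x q = y q from funext fun q => h q.val q rfl
  intro k
  induction k using Nat.strong_induction_on with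
  | _ k ih =>
    rintro q rfl
    have hpast : Code.past x q = Code.past y q :=
      funext fun j => ih j.val j.isLt (Fin.castLE q.isLt.le j) rfl
    have hq := Finset.ext_iff.1 hxy q
    simp only [mispredictions, Finset.mem_inter, Finset.mem_filter, Finset.mem_univ, true_and,
      hpast] at hq
    by_cases hfree : a q = b q
    · exact (le_antisymm (hfree ▸ hx.2 q) (hx.1 q)).trans
        (le_antisymm (hfree ▸ hy.2 q) (hy.1 q)).symm
    · generalize z q (Code.past y q) = guess at hq
      cases hxq : x q <;> cases hyq : y q <;> cases guess <;> simp_all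

lemma sum_pow_card_mispredictions_le (z : ∀ q : Fin n, (Fin q.val → Bool) → Bool)
    {a b : Fin n → Bool} {Q : Finset (Fin n → Bool)} (hQ : (Q : Set (Fin n → Bool)) ⊆ Set.Icc a b)
    {t : ℝ} (ht₀ : 0 ≤ t) (ht₁ : t ≤ 1) :
    ∑ x ∈ Q, t ^ (mispredictions z x).card ≤ (1 + t) ^ hammingDist a b := by
  let D : Finset (Fin n) := Finset.univ.filter fun j => a j ≠ b j
  calc ∑ x ∈ Q, t ^ (mispredictions z x).card
      ≤ ∑ x ∈ Q, t ^ (mispredictions z x ∩ D).card :=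
        Finset.sum_le_sum fun x _ =>
          pow_le_pow_of_le_one ht₀ ht₁ (Finset.card_le_card Finset.inter_subset_left)
    _ = ∑ s ∈ Q.image (mispredictions z · ∩ D), t ^ s.card := by
        rw [Finset.sum_image]
        exact (injOn_mispredictions_inter z a b).mono hQ
    _ ≤ ∑ s ∈ D.powerset, t ^ s.card := by
        refine Finset.sum_le_sum_of_subset_of_nonneg (fun s hs => ?_) fun _ _ _ => by positivity
        obtain ⟨x, -, rfl⟩ := Finset.mem_image.1 hs
        exact Finset.mem_powerset.2 Finset.inter_subset_right
    _ = (1 + t) ^ hammingDist a b := by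
        simpa [D, hammingDist, add_comm] using Finset.sum_pow_mul_eq_add_pow t 1 D

lemma card_le_two_pow_of_subset_Icc {a b : Fin n → Bool} {Q : Finset (Fin n → Bool)}
    (hQ : (Q : Set (Fin n → Bool)) ⊆ Set.Icc a b) : Q.card ≤ 2 ^ hammingDist a b := by
  have h := sum_pow_card_mispredictions_le (fun _ _ => false) hQ zero_le_one le_rfl
  norm_num at h
  exact_mod_cast h

/-- The estimate behind the exponential moment bound: `1 - exp (s * (r - k))` is at most one, and
nonpositive for `k ≤ r`. -/
lemma mul_one_sub_exp_le {r s k : ℝ} (hr : 0 ≤ r) (hs : 0 ≤ s) (hk : 0 ≤ k) :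
    r * (1 - Real.exp (s * r) * Real.exp (-s * k)) ≤ k := by
  rw [← Real.exp_add]
  have hpos := Real.exp_pos (s * r + -s * k)
  rcases le_total r k with hrk | hkr
  · nlinarith
  · have hone : 1 ≤ Real.exp (s * r + -s * k) := Real.one_le_exp (by nlinarith)
    nlinarith

lemma exp_mul_one_add_exp_le (η : ℝ) (l : ℕ) :
    Real.exp (4 * η * ((1 - 2 * η) * l)) * (1 + Real.exp (-(4 * η))) ^ (2 * l) ≤
      4 ^ l * Real.exp (-(4 * η ^ 2 * l)) := by
  have hcosh : 1 + Real.exp (-(4 * η)) = 2 * Real.exp (-(2 * η)) * Real.cosh (2 * η) := by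
    have hsquare : Real.exp (-(4 * η)) = Real.exp (-(2 * η)) * Real.exp (-(2 * η)) := by
      rw [← Real.exp_add]; ring_nf
    have hinv : Real.exp (-(2 * η)) * Real.exp (2 * η) = 1 := by simp [← Real.exp_add]
    rw [Real.cosh_eq, hsquare]
    linear_combination -hinv
  calc Real.exp (4 * η * ((1 - 2 * η) * l)) * (1 + Real.exp (-(4 * η))) ^ (2 * l)
      ≤ Real.exp (4 * η * ((1 - 2 * η) * l)) *
          (2 * Real.exp (-(2 * η)) * Real.exp ((2 * η) ^ 2 / 2)) ^ (2 * l) := by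
        rw [hcosh]
        gcongr
        exact Real.cosh_le_exp_half_sq _
    _ = 4 ^ l * Real.exp (-(4 * η ^ 2 * l)) := by
        rw [mul_assoc 2, ← Real.exp_add, mul_pow, ← Real.exp_nat_mul, pow_mul, mul_left_comm,
          ← Real.exp_add]
        norm_num
        ring

end Prediction

namespace Code

variable {n K M : ℕ} {p₀ : Bool → ℝ}

lemma sum_expectedDistortion_hamming (c : Code Bool n K M) (p₀ : Bool → ℝ)
    (z : ∀ q : Fin n, Fin M → (Fin q.val → Bool) → Bool) :
    ∑ q, c.expectedDistortion p₀ hamming q (z q) =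
      ∑ x, ∑ i, c.jointProb p₀ x i * (mispredictions (fun q => z q i) x).card := by
  simp only [expectedDistortion]
  rw [Finset.sum_comm]
  refine Finset.sum_congr rfl fun x _ => ?_
  rw [Finset.sum_comm]
  refine Finset.sum_congr rfl fun i _ => ?_
  rw [← Finset.mul_sum, mispredictions, Finset.card_filter]
  push_cast
  exact congrArg _ (Finset.sum_congr rfl fun q _ => by simp only [hamming, ite_not])

lemma le_forcedDistortion_of_sum_exp_le (c : Code Bool n K M) (hK : 0 < K) (hp₀ : ∀ a, 0 ≤ p₀ a)
    {T : Finset (Fin n → Bool)} {r s B : ℝ} (hr : 0 ≤ r) (hs : 0 ≤ s)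
    (hB : ∀ z : Fin M → ∀ q : Fin n, (Fin q.val → Bool) → Bool,
      ∑ i, ∑ x ∈ T, c.jointProb p₀ x i * Real.exp (-s) ^ (mispredictions (z i) x).card ≤ B) :
    (n : ℝ)⁻¹ * (r * (∑ x ∈ T, iidProb p₀ x - Real.exp (s * r) * B)) ≤
      c.forcedDistortion p₀ hamming := by
  obtain ⟨z, hz⟩ := c.exists_forcedDistortion_eq p₀ hamming
  rw [hz, sum_expectedDistortion_hamming]
  gcongr
  let k : (Fin n → Bool) → Fin M → ℕ := fun x i => (mispredictions (fun q => z q i) x).card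
  have hjoint := c.jointProb_nonneg hp₀
  calc r * (∑ x ∈ T, iidProb p₀ x - Real.exp (s * r) * B)
      ≤ r * (∑ x ∈ T, iidProb p₀ x - Real.exp (s * r) *
          ∑ i, ∑ x ∈ T, c.jointProb p₀ x i * Real.exp (-s) ^ k x i) := by
        gcongr
        exact hB fun i q => z q i
    _ = ∑ x ∈ T, ∑ i, c.jointProb p₀ x i *
          (r * (1 - Real.exp (s * r) * Real.exp (-s * k x i))) := by
        rw [Finset.sum_comm, Finset.mul_sum, ← Finset.sum_sub_distrib, Finset.mul_sum]
        refine Finset.sum_congr rfl fun x _ => ?_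
        rw [← c.sum_jointProb hK, Finset.mul_sum, ← Finset.sum_sub_distrib, Finset.mul_sum]
        refine Finset.sum_congr rfl fun i _ => ?_
        rw [mul_comm (-s), Real.exp_nat_mul]
        ring
    _ ≤ ∑ x ∈ T, ∑ i, c.jointProb p₀ x i * k x i := by
        gcongr with x _ i _
        · exact hjoint x i
        · exact mul_one_sub_exp_le hr hs (Nat.cast_nonneg _)
    _ ≤ ∑ x, ∑ i, c.jointProb p₀ x i * k x i :=
        Finset.sum_le_univ_sum_of_nonneg fun x =>
          Finset.sum_nonneg fun i _ => mul_nonneg (hjoint x i) (Nat.cast_nonneg _)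

section CubeCode

lemma card_filter_ofNat_eq_le {L : ℕ} [NeZero L] (hL : L ≤ K) (b : Fin L) :
    ((Finset.univ.filter fun ω : Fin K => Fin.ofNat L ω.val = b).card : ℝ) / K ≤ 2 / L := by
  have hLpos : 0 < L := Nat.pos_of_neZero L
  have hiff : ∀ k : ℕ, Fin.ofNat L k = b ↔ k ≡ b.val [MOD L] := fun k => by
    rw [Fin.ext_iff, Fin.val_ofNat, Nat.ModEq, Nat.mod_eq_of_lt b.isLt]
  have hcount : (Finset.univ.filter fun ω : Fin K => Fin.ofNat L ω.val = b).card ≤ K / L + 1 := by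
    simp only [hiff, Finset.card_filter]
    rw [Fin.sum_univ_eq_sum_range (fun k => if k ≡ b.val [MOD L] then 1 else 0),
      ← Finset.card_filter, ← Nat.count_eq_card_filter_range, Nat.count_modEq_card _ hLpos]
    gcongr
    split_ifs <;> simp
  have hdouble : (K / L + 1) * L ≤ 2 * K := by
    have := Nat.div_mul_le_self K L
    linarith
  rw [div_le_div_iff₀ (mod_cast hLpos.trans_le hL) (mod_cast hLpos)]
  exact_mod_cast (Nat.mul_le_mul_right L hcount).trans hdouble

lemma sum_jointProb_oneTimePad_mul_le {𝒳 : Type} [Fintype 𝒳] [Nonempty 𝒳] {p₀ : 𝒳 → ℝ}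
    {A B : Type*} [AddGroup B] [Fintype A] [Fintype B] [DecidableEq A] [DecidableEq B]
    {e : A × B ↪ Fin M} {φ : (Fin n → 𝒳) → A} {ψ : (Fin n → 𝒳) → B} {pad : Fin K → B}
    {T G : Finset (Fin n → 𝒳)} {κ E F : ℝ}
    (hκ : ∀ b, ((Finset.univ.filter (pad · = b)).card / K : ℝ) ≤ κ) (hE₀ : 0 ≤ E)
    (hE : ∀ x ∈ T, iidProb p₀ x ≤ E) {f : Fin M → (Fin n → 𝒳) → ℝ} (hf : ∀ i x, 0 ≤ f i x)
    (hF : ∀ a i, ∑ x ∈ T with φ x = a, f i x ≤ F) :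
    ∑ i, ∑ x ∈ T, (oneTimePad e φ ψ pad G).jointProb p₀ x i * f i x ≤
      Fintype.card A * Fintype.card B * (E * κ * F) := by
  have hκ₀ : 0 ≤ κ := le_trans (by positivity) (hκ 0)
  have hmessage : ∀ a b, ∑ x ∈ T, (oneTimePad e φ ψ pad G).jointProb p₀ x (e (a, b)) *
      f (e (a, b)) x ≤ E * κ * F := fun a b => by
    calc ∑ x ∈ T, (oneTimePad e φ ψ pad G).jointProb p₀ x (e (a, b)) * f (e (a, b)) x
        ≤ ∑ x ∈ T with φ x = a, E * κ * f (e (a, b)) x := by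
          simp only [jointProb_oneTimePad, ite_mul, zero_mul, Finset.sum_filter]
          gcongr with x hx
          split_ifs
          · gcongr
            exacts [hf _ _, hE x hx, hκ _]
          · rfl
      _ ≤ E * κ * F := by
          rw [← Finset.mul_sum]
          gcongr
          exact hF a _
  calc ∑ i, ∑ x ∈ T, (oneTimePad e φ ψ pad G).jointProb p₀ x i * f i x
      = ∑ i ∈ Finset.univ.map e, ∑ x ∈ T, (oneTimePad e φ ψ pad G).jointProb p₀ x i * f i x := by
        refine (Finset.sum_subset (Finset.subset_univ _) fun i _ hi =>
          Finset.sum_eq_zero fun x _ => ?_).symm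
        rw [jointProb_oneTimePad_of_notMem_range, zero_mul]
        simpa using hi
    _ ≤ ∑ _y : A × B, E * κ * F := by
        rw [Finset.sum_map]
        exact Finset.sum_le_sum fun y _ => hmessage y.1 y.2
    _ = Fintype.card A * Fintype.card B * (E * κ * F) := by simp

lemma exists_cube_coordinates {T : Finset (Fin n → Bool)} (hT : T.Nonempty) {l : ℕ}
    {𝒞 : Finset ((Fin n → Bool) × (Fin n → Bool))} (hdim : ∀ u ∈ 𝒞, hammingDist u.1 u.2 = 2 * l)
    (hcover : ∀ x ∈ T, ∃ u ∈ 𝒞, x ∈ Set.Icc u.1 u.2) :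
    ∃ (φ : (Fin n → Bool) → 𝒞) (ψ : (Fin n → Bool) → Fin (4 ^ l)),
      (∀ x ∈ T, x ∈ Set.Icc (φ x).1.1 (φ x).1.2) ∧ Set.InjOn (fun x => (φ x, ψ x)) T := by
  obtain ⟨x₀, hx₀⟩ := hT
  obtain ⟨u₀, hu₀, -⟩ := hcover x₀ hx₀
  have hφ : ∀ x, ∃ u : 𝒞, x ∈ T → x ∈ Set.Icc u.1.1 u.1.2 := fun x => by
    by_cases hx : x ∈ T
    · obtain ⟨u, hu, hxu⟩ := hcover x hx
      exact ⟨⟨u, hu⟩, fun _ => hxu⟩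
    · exact ⟨⟨u₀, hu₀⟩, fun h => (hx h).elim⟩
  choose φ hφ using hφ
  have hψ : ∀ u : 𝒞, ∃ f : (Fin n → Bool) → Fin (4 ^ l), Set.InjOn f (T.filter (φ · = u)) :=
    fun u => exists_injOn_of_card_le <| by
      have hfibre : ((T.filter (φ · = u) : Finset _) : Set (Fin n → Bool)) ⊆
          Set.Icc u.1.1 u.1.2 := fun x hx => by
        obtain ⟨hxT, rfl⟩ := Finset.mem_filter.1 hx
        exact hφ x hxT
      simpa [hdim u.1 u.2, pow_mul] using card_le_two_pow_of_subset_Icc hfibre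
  choose ψ hψ using hψ
  refine ⟨φ, fun x => ψ (φ x) x, hφ, fun x hx y hy hxy => ?_⟩
  obtain ⟨hcube, hposition⟩ := Prod.mk.inj hxy
  simp only [hcube] at hposition
  exact hψ _ (Finset.mem_filter.2 ⟨hx, hcube⟩) (Finset.mem_filter.2 ⟨hy, rfl⟩) hposition

/-- The code reveals a subcube of the cover that contains the source sequence, and sends the
position in it under a one-time pad. -/
lemma exists_le_forcedDistortion_of_cube_cover (hp₀ : ∀ a, 0 ≤ p₀ a) {T : Finset (Fin n → Bool)}
    (hT : T.Nonempty) {E : ℝ} (hE : ∀ x ∈ T, iidProb p₀ x ≤ E) {l : ℕ}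
    {𝒞 : Finset ((Fin n → Bool) × (Fin n → Bool))} (hdim : ∀ u ∈ 𝒞, hammingDist u.1 u.2 = 2 * l)
    (hcover : ∀ x ∈ T, ∃ u ∈ 𝒞, x ∈ Set.Icc u.1 u.2) (hK : 4 ^ l ≤ K)
    (hM : 𝒞.card * 4 ^ l ≤ M) :
    ∃ c : Code Bool n K M, c.IsDeterministic ∧ ∑ x ∈ T, iidProb p₀ x ≤ c.successProb p₀ ∧
      ∀ η : ℝ, 0 ≤ η → η ≤ 1 / 2 →
        (n : ℝ)⁻¹ * ((1 - 2 * η) * l * (∑ x ∈ T, iidProb p₀ x -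
          2 * (𝒞.card * 4 ^ l) * Real.exp (-(4 * η ^ 2 * l)) * E)) ≤
        c.forcedDistortion p₀ hamming := by
  classical
  have hE₀ : 0 ≤ E := hT.elim fun x hx => (iidProb_nonneg hp₀ x).trans (hE x hx)
  have hKpos : 0 < K := Nat.pos_of_neZero (4 ^ l) |>.trans_le hK
  obtain ⟨e⟩ := Function.Embedding.nonempty_of_card_le (α := 𝒞 × Fin (4 ^ l)) (β := Fin M)
    (by simpa using hM)
  obtain ⟨φ, ψ, hφ, hinj⟩ := exists_cube_coordinates hT hdim hcover
  refine ⟨oneTimePad e φ ψ (fun ω => Fin.ofNat (4 ^ l) ω.val) T,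
    ofFun_isDeterministic _ _, sum_le_successProb_oneTimePad hKpos hp₀ hinj, fun η hη₀ hη => ?_⟩
  have herrors : ∀ (z : ∀ q : Fin n, (Fin q.val → Bool) → Bool) (u : 𝒞),
      ∑ x ∈ T with φ x = u, Real.exp (-(4 * η)) ^ (mispredictions z x).card ≤
        (1 + Real.exp (-(4 * η))) ^ (2 * l) := fun z u => by
    rw [← hdim u.1 u.2]
    refine sum_pow_card_mispredictions_le z (fun x hx => ?_) (Real.exp_nonneg _)
      (Real.exp_le_one_iff.2 (by linarith))
    obtain ⟨hxT, rfl⟩ := Finset.mem_filter.1 hx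
    exact hφ x hxT
  refine le_trans ?_ (le_forcedDistortion_of_sum_exp_le _ hKpos hp₀ (r := (1 - 2 * η) * l)
    (s := 4 * η) (mul_nonneg (by linarith) (Nat.cast_nonneg l)) (by positivity) fun z =>
    sum_jointProb_oneTimePad_mul_le (card_filter_ofNat_eq_le hK) hE₀ hE (fun i x => by positivity)
      fun u i => herrors (z i) u)
  refine mul_le_mul_of_nonneg_left (mul_le_mul_of_nonneg_left (sub_le_sub_left ?_ _)
    (mul_nonneg (by linarith) (Nat.cast_nonneg l))) (by positivity)
  calc Real.exp (4 * η * ((1 - 2 * η) * l)) * (Fintype.card 𝒞 * Fintype.card (Fin (4 ^ l)) *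
        (E * (2 / (4 ^ l : ℕ)) * (1 + Real.exp (-(4 * η))) ^ (2 * l)))
      = 2 * 𝒞.card * E * (Real.exp (4 * η * ((1 - 2 * η) * l)) *
          (1 + Real.exp (-(4 * η))) ^ (2 * l)) := by
        simp only [Fintype.card_coe, Fintype.card_fin, Nat.cast_pow, Nat.cast_ofNat]
        field_simp
    _ ≤ 2 * 𝒞.card * E * (4 ^ l * Real.exp (-(4 * η ^ 2 * l))) :=
        mul_le_mul_of_nonneg_left (exp_mul_one_add_exp_le η l) (by positivity)
    _ = 2 * (𝒞.card * 4 ^ l) * Real.exp (-(4 * η ^ 2 * l)) * E := by ring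

end CubeCode

end Code

/-! ### Converses for sequences of codes -/

section NumValues

variable {n : ℕ} {R : ℝ}

lemma two_rpow_mul_eq_exp (n : ℕ) (R : ℝ) :
    (2 : ℝ) ^ ((n : ℝ) * R) = Real.exp (n * (R * Real.log 2)) := by
  rw [Real.rpow_def_of_pos two_pos]
  ring_nf

lemma numValues_le_exp (n : ℕ) (R : ℝ) : (numValues n R : ℝ) ≤ Real.exp (n * (R * Real.log 2)) :=
  (Nat.floor_le (by positivity)).trans_eq (two_rpow_mul_eq_exp n R)

lemma le_numValues {k : ℕ} (h : (k : ℝ) ≤ Real.exp (n * (R * Real.log 2))) : k ≤ numValues n R :=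
  Nat.le_floor (h.trans_eq (two_rpow_mul_eq_exp n R).symm)

lemma numValues_pos (n : ℕ) (hR : 0 ≤ R) : 0 < numValues n R :=
  le_numValues (by simpa using show 0 ≤ n * (R * Real.log 2) by positivity)

lemma log_numValues_le (h : 0 < numValues n R) :
    Real.log (numValues n R) ≤ n * (R * Real.log 2) :=
  (Real.log_le_iff_le_exp (mod_cast h)).2 (numValues_le_exp n R)

end NumValues

section Converse

variable {𝒳 : Type} [Fintype 𝒳] {p₀ : 𝒳 → ℝ}

lemma Code.pos_of_successProb_pos {n K M : ℕ} {c : Code 𝒳 n K M} (h : 0 < c.successProb p₀) :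
    0 < K := by
  rcases Nat.eq_zero_or_pos K with rfl | hK
  · simp [successProb] at h
  · exact hK

variable {K M : ℕ → ℕ} {c : ∀ n, Code 𝒳 n (K n) (M n)}

lemma eventually_keys_pos (hc : Tendsto (fun n => (c n).successProb p₀) atTop (𝓝 1)) :
    ∀ᶠ n in atTop, 0 < K n :=
  (hc.eventually (lt_mem_nhds one_pos)).mono fun _ => Code.pos_of_successProb_pos

lemma eventually_mul_entropy_le (hp₀ : p₀ ∈ stdSimplex ℝ 𝒳) {m : ℕ → ℕ} (hm : ∀ n, m n ≤ n)
    (hhide : ∀ n, (c n).HidesPrefix p₀ (m n))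
    (hc : Tendsto (fun n => (c n).successProb p₀) atTop (𝓝 1)) {κ : ℝ}
    (hκ : ∀ n, (K n : ℝ) ≤ Real.exp (n * κ)) {δ : ℝ} (hδ : 0 < δ) :
    ∀ᶠ n : ℕ in atTop, m n * entropy p₀ ≤ n * (κ + 2 * δ) := by
  have hsuccess : Tendsto (fun n : ℕ => (c n).successProb p₀ - varentropy p₀ / δ ^ 2 / n) atTop
      (𝓝 1) := by
    simpa using hc.sub (tendsto_const_div_atTop_nhds_zero_nat (varentropy p₀ / δ ^ 2))
  filter_upwards [eventually_keys_pos hc, eventually_gt_atTop 0,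
    hsuccess.eventually (lt_mem_nhds one_half_lt_one),
    tendsto_natCast_atTop_atTop.eventually_ge_atTop (Real.log 2 / δ)] with n hK hn hhalf hlog
  have hnpos : (0 : ℝ) < n := mod_cast hn
  rw [div_le_iff₀ hδ] at hlog
  have hchebyshev : m n * varentropy p₀ / (δ * n) ^ 2 ≤ varentropy p₀ / δ ^ 2 / n := by
    calc m n * varentropy p₀ / (δ * n) ^ 2 ≤ n * varentropy p₀ / (δ * n) ^ 2 := by
          have := varentropy_nonneg hp₀.1
          gcongr
          exact hm n
      _ = varentropy p₀ / δ ^ 2 / n := by field_simp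
  have hlower : 1 / 2 ≤ Real.exp (n * κ + (-(m n * entropy p₀) + δ * n)) := by
    rw [Real.exp_add]
    have hle := (hhide n).successProb_le (hm n) hK hp₀ (mul_pos hδ hnpos)
    have := mul_le_mul_of_nonneg_right (hκ n) (Real.exp_nonneg (-(m n * entropy p₀) + δ * n))
    linarith
  rw [← Real.log_le_iff_le_exp one_half_pos, one_div, Real.log_inv] at hlower
  linarith

end Converse

section RegionConverses

variable {𝒳 𝒵 : Type} [Fintype 𝒳] {p₀ : 𝒳 → ℝ} {k : CodeClass} {R₀ R D : ℝ}

lemma CanForce.le_blindDistortion [Finite 𝒵] [Nonempty 𝒵] {d : 𝒳 → 𝒵 → ℝ} (hp₀ : ∑ a, p₀ a = 1)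
    (h : CanForce k p₀ d R₀ R D) : D ≤ blindDistortion p₀ d := by
  obtain ⟨c, -, hc, hD⟩ := h
  obtain ⟨n, hK, hn⟩ := ((eventually_keys_pos hc).and (eventually_gt_atTop 0)).exists
  exact (hD n hn).trans ((c n).forcedDistortion_le_blindDistortion hn hK hp₀)

lemma CanForce.le_half_key_rate {p₀ : Bool → ℝ} (hp₀ : p₀ ∈ stdSimplex ℝ Bool)
    (h : CanForce k p₀ hamming R₀ R D) : D ≤ R₀ / 2 := by
  obtain ⟨c, -, hc, hD⟩ := h
  have hlim : Tendsto (fun n => R₀ / 2 + (1 - (c n).successProb p₀)) atTop (𝓝 (R₀ / 2)) := by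
    simpa using (hc.const_sub 1).const_add (R₀ / 2)
  refine ge_of_tendsto hlim ?_
  filter_upwards [eventually_keys_pos hc, eventually_gt_atTop 0] with n hK hn
  refine (hD n hn).trans (((c n).forcedDistortion_le_log hn hK hp₀).trans ?_)
  gcongr
  calc (n : ℝ)⁻¹ * (Real.log (numValues n R₀) / Real.log 4)
      ≤ (n : ℝ)⁻¹ * (n * (R₀ * Real.log 2) / Real.log 4) := by
        gcongr
        exact log_numValues_le hK
    _ = R₀ / 2 := by
        rw [show Real.log 4 = 2 * Real.log 2 by
          rw [show (4 : ℝ) = 2 ^ 2 by norm_num, Real.log_pow, Nat.cast_ofNat]]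
        field_simp

lemma CanForceNaively.mul_entropy_le {d : 𝒳 → 𝒳 → ℝ} (hp₀ : p₀ ∈ stdSimplex ℝ 𝒳)
    (hd₀ : ∀ a b, 0 ≤ d a b) (hd₁ : ∀ a b, d a b ≤ 1) (hd : ∀ a, d a a = 0)
    (h : CanForceNaively k p₀ d R₀ R D) :
    D * entropy p₀ ≤ R₀ * Real.log 2 * blindDistortion p₀ d := by
  obtain ⟨c, m, r, -, hm, hhide, hreveal, hc, hD⟩ := h
  have hblind := blindDistortion_nonneg hp₀.1 hd₀
  have hslack : Tendsto (fun δ : ℝ => (R₀ * Real.log 2 + 2 * δ) * blindDistortion p₀ d) (𝓝[>] 0)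
      (𝓝 (R₀ * Real.log 2 * blindDistortion p₀ d)) := by
    refine tendsto_nhdsWithin_of_tendsto_nhds (Continuous.tendsto' (by fun_prop) _ _ (by simp))
  refine ge_of_tendsto hslack (eventually_mem_nhdsWithin.mono fun δ hδ => ?_)
  have hlim : Tendsto (fun n => (R₀ * Real.log 2 + 2 * δ) * blindDistortion p₀ d +
      (1 - (c n).revealProb p₀ (m n) (r n)) * entropy p₀) atTop
      (𝓝 ((R₀ * Real.log 2 + 2 * δ) * blindDistortion p₀ d)) := by
    simpa using ((hreveal.const_sub 1).mul_const (entropy p₀)).const_add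
      ((R₀ * Real.log 2 + 2 * δ) * blindDistortion p₀ d)
  refine ge_of_tendsto hlim ?_
  filter_upwards [eventually_keys_pos hc, eventually_gt_atTop 0, eventually_mul_entropy_le hp₀ hm
    hhide hc (fun n => numValues_le_exp n R₀) hδ] with n hK hn hprefix
  have hnpos : (0 : ℝ) < n := mod_cast hn
  calc D * entropy p₀
      ≤ (m n / n * blindDistortion p₀ d + (1 - (c n).revealProb p₀ (m n) (r n))) * entropy p₀ :=
        mul_le_mul_of_nonneg_right ((hD n hn).trans
          ((c n).forcedDistortion_le_of_revealProb hn hK hp₀ hd hd₁ (hm n) (r n)))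
          (entropy_nonneg hp₀)
    _ = m n * entropy p₀ / n * blindDistortion p₀ d +
          (1 - (c n).revealProb p₀ (m n) (r n)) * entropy p₀ := by ring
    _ ≤ _ := by
        gcongr
        rwa [div_le_iff₀' hnpos]

lemma entropy_le_of_perfectlySecret {K M : ℕ → ℕ} {c : ∀ n, Code 𝒳 n (K n) (M n)} {κ : ℝ}
    (hp₀ : p₀ ∈ stdSimplex ℝ 𝒳) (hκ : ∀ n, (K n : ℝ) ≤ Real.exp (n * κ))
    (hsecret : ∀ n, (c n).PerfectlySecret p₀)
    (hc : Tendsto (fun n => (c n).successProb p₀) atTop (𝓝 1)) : entropy p₀ ≤ κ := by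
  refine le_of_forall_pos_le_add fun ε hε => ?_
  obtain ⟨n, hle, hn⟩ := ((eventually_mul_entropy_le hp₀ (fun n => le_refl n) hsecret hc hκ
    (half_pos hε)).and (eventually_gt_atTop 0)).exists
  have := le_of_mul_le_mul_left hle (mod_cast hn)
  linarith

end RegionConverses

/-! ### Naive codes and codes with perfect secrecy -/

lemma Code.IsDeterministic.inClass {𝒳 : Type} [Fintype 𝒳] {n K M : ℕ} {c : Code 𝒳 n K M}
    (h : c.IsDeterministic) : ∀ k : CodeClass, c.InClass k
  | .deterministic => h
  | .randomized => trivial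

section Sequences

variable {𝒳 : Type} [Fintype 𝒳] {p₀ : 𝒳 → ℝ}

lemma Code.revealProb_self {n K M : ℕ} (c : Code 𝒳 n K M) (hK : 0 < K) (hp₀ : ∑ a, p₀ a = 1)
    (r : Fin M → Fin n → 𝒳) : c.revealProb p₀ n r = 1 := by
  have hvacuous : ∀ (x : Fin n → 𝒳) (i : Fin M), ∀ j : Fin n, n ≤ j.val → r i j = x j :=
    fun _ _ j hj => absurd j.isLt hj.not_gt
  rw [← c.sum_sum_jointProb hK hp₀, Finset.sum_comm, revealProb, prob]
  exact Finset.sum_congr rfl fun x _ => Finset.sum_congr rfl fun i _ => if_pos (hvacuous x i)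

/-- The finitely many block lengths that the asymptotic construction misses are filled in by
perfectly secret codes, which need not transmit anything. -/
lemma exists_code_sequence {K M : ℕ → ℕ} (hp₀ : p₀ ∈ stdSimplex ℝ 𝒳) (hK : ∀ n, 0 < K n)
    (hM : ∀ n, 0 < M n) {s : ℕ → ℝ} (hs : Tendsto s atTop (𝓝 1))
    {Q : ∀ n, Code 𝒳 n (K n) (M n) → Prop}
    (hsecret : ∀ n (c : Code 𝒳 n (K n) (M n)), c.PerfectlySecret p₀ → Q n c)
    (hQ : ∀ᶠ n in atTop, ∃ c : Code 𝒳 n (K n) (M n),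
      c.IsDeterministic ∧ s n ≤ c.successProb p₀ ∧ Q n c) :
    ∃ c : ∀ n, Code 𝒳 n (K n) (M n), (∀ n, (c n).IsDeterministic) ∧
      Tendsto (fun n => (c n).successProb p₀) atTop (𝓝 1) ∧ ∀ n, Q n (c n) := by
  have hcodes : ∀ n, ∃ c : Code 𝒳 n (K n) (M n), c.IsDeterministic ∧ Q n c ∧
      ((∃ c : Code 𝒳 n (K n) (M n), c.IsDeterministic ∧ s n ≤ c.successProb p₀ ∧ Q n c) →
        s n ≤ c.successProb p₀) := fun n => by
    by_cases h : ∃ c : Code 𝒳 n (K n) (M n),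
        c.IsDeterministic ∧ s n ≤ c.successProb p₀ ∧ Q n c
    · obtain ⟨c, hdet, hsuccess, hQc⟩ := h
      exact ⟨c, hdet, hQc, fun _ => hsuccess⟩
    · obtain ⟨c, hdet, hc⟩ := Code.exists_perfectlySecret n (hK n) (hM n) hp₀.2
      exact ⟨c, hdet, hsecret n c hc, fun h' => absurd h' h⟩
  choose c hdet hQc hsuccess using hcodes
  exact ⟨c, hdet, tendsto_of_tendsto_of_tendsto_of_le_of_le' hs tendsto_const_nhds
    (hQ.mono fun n => hsuccess n)
    (Eventually.of_forall fun n => (c n).successProb_le_one (hK n) hp₀), hQc⟩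

lemma tendsto_one_sub_const_div (V : ℝ) : Tendsto (fun n : ℕ => 1 - V / n) atTop (𝓝 1) := by
  simpa using (tendsto_const_div_atTop_nhds_zero_nat V).const_sub 1

end Sequences

section NaiveCodes

variable {𝒳 𝒵 : Type} [Fintype 𝒳] {p₀ : 𝒳 → ℝ} {R₀ R : ℝ}

lemma card_prefix {n m : ℕ} (hm : m ≤ n) : Fintype.card {j : Fin n // j.val < m} = m := by
  rw [Fintype.card_subtype, Fin.card_filter_val_lt, min_eq_right hm]

lemma card_suffix {n m : ℕ} (hm : m ≤ n) : Fintype.card {j : Fin n // ¬ j.val < m} = n - m := by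
  rw [Fintype.card_subtype_compl, card_prefix hm, Fintype.card_fin]

lemma exists_hidesPrefix (hp₀ : p₀ ∈ stdSimplex ℝ 𝒳) {n m : ℕ} (hn : 0 < n) (hm : m ≤ n)
    {δ : ℝ} (hδ : 0 < δ) (hR₀ : m * entropy p₀ + δ * n ≤ n * (R₀ * Real.log 2))
    (hR : n * (R₀ * Real.log 2) + ((n - m) * entropy p₀ + δ * n) ≤ n * (R * Real.log 2)) :
    ∃ (c : Code 𝒳 n (numValues n R₀) (numValues n R)) (r : Fin (numValues n R) → Fin n → 𝒳),
      c.IsDeterministic ∧ c.HidesPrefix p₀ m ∧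
      1 - 2 * varentropy p₀ / δ ^ 2 / n ≤ c.revealProb p₀ m r ∧
      1 - 2 * varentropy p₀ / δ ^ 2 / n ≤ c.successProb p₀ := by
  have hH := entropy_nonneg hp₀
  have hvar := varentropy_nonneg hp₀.1
  have hmn : (m : ℝ) ≤ n := mod_cast hm
  let T₁ := typical {j : Fin n // j.val < m} p₀ (δ * n)
  let T₂ := typical {j : Fin n // ¬ j.val < m} p₀ (δ * n)
  have hT₁ : T₁.card ≤ numValues n R₀ := le_numValues <|
    (card_le_exp_of_subset_typical hp₀ subset_rfl).trans (by rwa [Real.exp_le_exp, card_prefix hm])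
  have hT₂ : (T₂.card : ℝ) ≤ Real.exp ((n - m) * entropy p₀ + δ * n) := by
    simpa only [card_suffix hm, Nat.cast_sub hm] using
      card_le_exp_of_subset_typical hp₀ (Finset.Subset.refl T₂)
  have hN : ((max 1 T₂.card : ℕ) : ℝ) ≤ Real.exp ((n - m) * entropy p₀ + δ * n) := by
    rw [Nat.cast_max, Nat.cast_one]
    have := mul_nonneg (sub_nonneg.2 hmn) hH
    exact max_le (Real.one_le_exp (by positivity)) hT₂
  have hM : max 1 T₂.card * numValues n R₀ ≤ numValues n R := by
    refine le_numValues ?_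
    calc ((max 1 T₂.card * numValues n R₀ : ℕ) : ℝ)
        ≤ Real.exp ((n - m) * entropy p₀ + δ * n) * Real.exp (n * (R₀ * Real.log 2)) := by
          rw [Nat.cast_mul]
          gcongr
          exact numValues_le_exp n R₀
      _ ≤ Real.exp (n * (R * Real.log 2)) := by
          rw [← Real.exp_add, Real.exp_le_exp, add_comm]
          exact hR
  have hK : 0 < numValues n R₀ := le_numValues (by
    rw [Nat.succ_eq_add_one, zero_add, Nat.cast_one]
    exact Real.one_le_exp (le_trans (by positivity) hR₀))
  obtain ⟨c, r, hdet, hhide, hreveal, hsuccess⟩ := Code.exists_hidesPrefix_of_card_le hp₀ hK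
    (le_max_left 1 T₂.card) hM hT₁ (le_max_right 1 T₂.card)
  have hV : 0 ≤ varentropy p₀ / δ ^ 2 / n := by positivity
  have hP₁ := one_sub_div_le_sum_typical hp₀ hn ((card_prefix hm).trans_le hm) hδ
  have hP₂ := one_sub_div_le_sum_typical hp₀ hn ((card_suffix hm).trans_le (n.sub_le m)) hδ
  have hP₁' := sum_iidProb_le_one hp₀ T₁
  have hP₂' := sum_iidProb_le_one hp₀ T₂
  rw [mul_div_assoc, mul_div_assoc]
  exact ⟨c, r, hdet, hhide, by linarith, by nlinarith⟩

lemma eventually_exists_hidesPrefix (hp₀ : p₀ ∈ stdSimplex ℝ 𝒳) {β : ℝ} (hβ₀ : 0 ≤ β) (hβ₁ : β ≤ 1)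
    (hR₀ : β * entropy p₀ < R₀ * Real.log 2)
    (hR : R₀ * Real.log 2 + (1 - β) * entropy p₀ < R * Real.log 2) :
    ∃ V : ℝ, 0 ≤ V ∧ ∀ᶠ n : ℕ in atTop,
      ∃ (c : Code 𝒳 n (numValues n R₀) (numValues n R)) (r : Fin (numValues n R) → Fin n → 𝒳),
        c.IsDeterministic ∧ c.HidesPrefix p₀ ⌈β * n⌉₊ ∧
        1 - V / n ≤ c.revealProb p₀ ⌈β * n⌉₊ r ∧ 1 - V / n ≤ c.successProb p₀ := by
  obtain ⟨δ, hδ, hδ'⟩ := exists_between <| show 0 < min ((R₀ * Real.log 2 - β * entropy p₀) / 2)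
      (R * Real.log 2 - (R₀ * Real.log 2 + (1 - β) * entropy p₀)) from
    lt_min (by linarith) (by linarith)
  obtain ⟨hδ₁, hδ₂⟩ := lt_min_iff.1 hδ'
  have hH := entropy_nonneg hp₀
  have hvar := varentropy_nonneg hp₀.1
  refine ⟨2 * varentropy p₀ / δ ^ 2, by positivity, ?_⟩
  filter_upwards [eventually_gt_atTop 0,
    tendsto_natCast_atTop_atTop.eventually_ge_atTop (entropy p₀ / δ)] with n hn hlarge
  rw [div_le_iff₀ hδ] at hlarge
  have hnpos : (0 : ℝ) < n := mod_cast hn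
  have hceil : (⌈β * n⌉₊ : ℝ) ≤ β * n + 1 := (Nat.ceil_lt_add_one (by positivity)).le
  have hlength := mul_le_mul_of_nonneg_right hceil hH
  have hrest := mul_le_mul_of_nonneg_right (Nat.le_ceil (β * n)) hH
  refine exists_hidesPrefix hp₀ hn (Nat.ceil_le.2 (mul_le_of_le_one_left hnpos.le hβ₁)) hδ ?_ ?_
  · nlinarith
  · nlinarith

lemma canForceNaively_mul_blindDistortion [Finite 𝒵] [Nonempty 𝒵] {d : 𝒳 → 𝒵 → ℝ} (k : CodeClass)
    (hp₀ : p₀ ∈ stdSimplex ℝ 𝒳) (hd : ∀ a b, 0 ≤ d a b) {β : ℝ} (hβ₀ : 0 ≤ β) (hβ₁ : β ≤ 1)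
    (hR₀ : β * entropy p₀ < R₀ * Real.log 2)
    (hR : R₀ * Real.log 2 + (1 - β) * entropy p₀ < R * Real.log 2) :
    CanForceNaively k p₀ d R₀ R (β * blindDistortion p₀ d) := by
  have hH := entropy_nonneg hp₀
  have hblind := blindDistortion_nonneg hp₀.1 hd
  have hlog : 0 < Real.log 2 := Real.log_pos one_lt_two
  have hR₀' : 0 ≤ R₀ := nonneg_of_mul_nonneg_left ((mul_nonneg hβ₀ hH).trans hR₀.le) hlog
  have hR' : 0 ≤ R := nonneg_of_mul_nonneg_left (le_trans
    (add_nonneg (by positivity) (mul_nonneg (sub_nonneg.2 hβ₁) hH)) hR.le) hlog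
  obtain ⟨V, hV, hcodes⟩ := eventually_exists_hidesPrefix hp₀ hβ₀ hβ₁ hR₀ hR
  obtain ⟨a₀⟩ := nonempty_of_sum_eq_one hp₀.2
  let Q : ∀ n, Code 𝒳 n (numValues n R₀) (numValues n R) → Prop := fun n c =>
    ∃ (m : ℕ) (r : Fin (numValues n R) → Fin n → 𝒳), m ≤ n ∧ c.HidesPrefix p₀ m ∧
      1 - V / n ≤ c.revealProb p₀ m r ∧ β * n ≤ m
  have hsecret : ∀ n c, c.PerfectlySecret p₀ → Q n c := fun n c hc => by
    refine ⟨n, fun _ _ => a₀, le_rfl, hc, ?_, mul_le_of_le_one_left n.cast_nonneg hβ₁⟩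
    rw [c.revealProb_self (numValues_pos n hR₀') hp₀.2]
    exact sub_le_self _ (by positivity)
  have hQ : ∀ᶠ n : ℕ in atTop, ∃ c, c.IsDeterministic ∧ 1 - V / n ≤ c.successProb p₀ ∧ Q n c :=
    hcodes.mono fun n ⟨c, r, hdet, hhide, hreveal, hsuccess⟩ =>
      ⟨c, hdet, hsuccess, _, r, Nat.ceil_le.2 (mul_le_of_le_one_left n.cast_nonneg hβ₁), hhide,
        hreveal, Nat.le_ceil _⟩
  obtain ⟨c, hdet, hc, hcQ⟩ := exists_code_sequence hp₀ (fun n => numValues_pos n hR₀')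
    (fun n => numValues_pos n hR') (tendsto_one_sub_const_div V) hsecret hQ
  choose m r hm hhide hreveal hlength using hcQ
  refine ⟨c, m, r, fun n => (hdet n).inClass k, hm, hhide,
    tendsto_of_tendsto_of_tendsto_of_le_of_le (tendsto_one_sub_const_div V) tendsto_const_nhds
      hreveal fun n => (c n).revealProb_le_one (numValues_pos n hR₀') hp₀ _ _, hc,
    fun n hn => le_trans ?_ ((hhide n).le_forcedDistortion (hm n) (numValues_pos n hR₀') hp₀ hd)⟩
  gcongr
  rw [le_div_iff₀ (mod_cast hn)]
  exact hlength n

lemma exists_perfectlySecret_sequence (k : CodeClass) (hp₀ : p₀ ∈ stdSimplex ℝ 𝒳)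
    (hR₀ : entropy p₀ < R₀ * Real.log 2) (hR : R₀ < R) :
    ∃ c : ∀ n : ℕ, Code 𝒳 n (numValues n R₀) (numValues n R), (∀ n, (c n).InClass k) ∧
      (∀ n, (c n).PerfectlySecret p₀) ∧
      Tendsto (fun n => (c n).successProb p₀) atTop (𝓝 1) := by
  have hlog : 0 < Real.log 2 := Real.log_pos one_lt_two
  have hR₀' : 0 ≤ R₀ := nonneg_of_mul_nonneg_left ((entropy_nonneg hp₀).trans hR₀.le) hlog
  obtain ⟨V, -, hcodes⟩ := eventually_exists_hidesPrefix (R := R) hp₀ zero_le_one le_rfl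
    (by rwa [one_mul]) (by rw [sub_self, zero_mul, add_zero]; gcongr)
  obtain ⟨c, hdet, hc, hsecret⟩ := exists_code_sequence hp₀ (fun n => numValues_pos n hR₀')
    (fun n => numValues_pos n (hR₀'.trans hR.le)) (tendsto_one_sub_const_div V)
    (Q := fun n c => c.PerfectlySecret p₀) (fun _ _ h => h) (hcodes.mono fun n h => by
      obtain ⟨c, -, hdet, hhide, -, hsuccess⟩ := h
      rw [one_mul, Nat.ceil_natCast] at hhide
      exact ⟨c, hdet, hsuccess, hhide⟩)
  exact ⟨c, fun n => (hdet n).inClass k, hsecret, hc⟩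

end NaiveCodes

/-! ### Bernoulli sources -/

section Bernoulli

variable {p : ℝ}

lemma bernoulli_mem_stdSimplex (hp0 : 0 ≤ p) (hp1 : p ≤ 1) :
    bernoulli p ∈ stdSimplex ℝ Bool :=
  ⟨fun b => by cases b <;> simp [bernoulli, hp0, hp1], by simp [bernoulli]⟩

lemma entropy_bernoulli (p : ℝ) : entropy (bernoulli p) = Real.binEntropy p := by
  simp [entropy, bernoulli, Real.binEntropy_eq_negMulLog_add_negMulLog_one_sub]

lemma binaryEntropy_mul_log_two (p : ℝ) :
    binaryEntropy p * Real.log 2 = entropy (bernoulli p) := by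
  rw [binaryEntropy, entropy_bernoulli, div_mul_cancel₀ _ (Real.log_pos one_lt_two).ne']

/-- The binary entropy function lies above its chord from `0` to `1 / 2`. -/
lemma two_mul_lt_binaryEntropy (hp0 : 0 < p) (hp : p < 1 / 2) : 2 * p < binaryEntropy p := by
  have hchord := Real.strictConcave_binEntropy.2 (x := 0) (y := 2⁻¹) (by simp)
    (by constructor <;> norm_num) (by norm_num) (by linarith : 0 < 1 - 2 * p)
    (by linarith : 0 < 2 * p) (by ring)
  rw [Real.binEntropy_zero, Real.binEntropy_two_inv, smul_zero, zero_add, zero_add,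
    smul_eq_mul, smul_eq_mul, mul_right_comm 2 p 2⁻¹, mul_inv_cancel₀ two_ne_zero, one_mul]
    at hchord
  rwa [binaryEntropy, lt_div_iff₀ (Real.log_pos one_lt_two)]

lemma binaryEntropy_pos (hp0 : 0 < p) (hp : p < 1 / 2) : 0 < binaryEntropy p :=
  (mul_pos two_pos hp0).trans (two_mul_lt_binaryEntropy hp0 hp)

lemma blindDistortion_bernoulli (hp : p ≤ 1 / 2) :
    blindDistortion (bernoulli p) hamming = p := by
  have hfalse : ∑ a, bernoulli p a * hamming a false = p := by simp [bernoulli, hamming]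
  have htrue : ∑ a, bernoulli p a * hamming a true = 1 - p := by simp [bernoulli, hamming]
  refine le_antisymm ((ciInf_le (Set.finite_range _).bddBelow false).trans_eq hfalse)
    (le_ciInf fun z => ?_)
  cases z
  · exact hfalse.ge
  · linarith

/-- The log-odds of a Bernoulli-`p` bit being `false`: by this much the information content of a
sequence grows when a `false` is replaced by a `true`. -/
def logOdds (p : ℝ) : ℝ := Real.log (1 - p) - Real.log p

lemma logOdds_pos (hp0 : 0 < p) (hp : p < 1 / 2) : 0 < logOdds p :=
  sub_pos.2 (Real.log_lt_log hp0 (by linarith))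

lemma four_pow_eq_exp (l : ℕ) : (4 : ℝ) ^ l = Real.exp (l * (2 * Real.log 2)) := by
  rw [Real.exp_nat_mul, mul_comm, Real.exp_mul, Real.exp_log two_pos]
  norm_num

section Typical

variable {ι : Type*} [Fintype ι] {x : ι → Bool} {b : ℝ}

lemma iidProb_bernoulli (hp0 : 0 < p) (hp1 : p < 1) (x : ι → Bool) :
    iidProb (bernoulli p) x = Real.exp (-(Fintype.card ι * entropy (bernoulli p)) -
      (weight x - Fintype.card ι * p) * logOdds p) := by
  have hpos : ∀ a, 0 < bernoulli p a := fun a => by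
    cases a <;> simp [bernoulli, hp0, hp1]
  have hlog : ∀ a, Real.log (bernoulli p a) =
      Real.log (1 - p) - (if a = true then 1 else 0) * logOdds p := fun a => by
    cases a <;> simp [bernoulli, logOdds]
  have hiid : 0 < iidProb (bernoulli p) x := Finset.prod_pos fun j _ => hpos (x j)
  rw [← Real.exp_log hiid, log_iidProb hiid.ne']
  simp only [hlog, Finset.sum_sub_distrib, ← Finset.sum_mul, Finset.sum_const, Finset.card_univ,
    nsmul_eq_mul, Finset.sum_boole, weight, entropy_bernoulli, logOdds,
    Real.binEntropy_eq_negMulLog_add_negMulLog_one_sub, Real.negMulLog]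
  ring_nf

lemma mem_typical_bernoulli (hp0 : 0 < p) (hp1 : p < 1) :
    x ∈ typical ι (bernoulli p) b ↔ |(weight x - Fintype.card ι * p) * logOdds p| ≤ b := by
  rw [mem_typical, iidProb_bernoulli hp0 hp1, Real.exp_le_exp, Real.exp_le_exp, abs_le]
  constructor <;> rintro ⟨h₁, h₂⟩ <;> constructor <;> linarith

lemma le_weight_of_mem_typical (hp0 : 0 < p) (hp : p < 1 / 2) {l : ℕ}
    (hl : b ≤ (Fintype.card ι * p - l) * logOdds p) (hx : x ∈ typical ι (bernoulli p) b) :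
    l ≤ weight x ∧ weight x + l ≤ Fintype.card ι := by
  have hodds := logOdds_pos hp0 hp
  obtain ⟨h₁, h₂⟩ := abs_le.1 (((mem_typical_bernoulli hp0 (by linarith)).1 hx).trans hl)
  rw [← neg_mul] at h₁
  have hlower := le_of_mul_le_mul_right h₁ hodds
  have hupper := le_of_mul_le_mul_right h₂ hodds
  have hcard : (0 : ℝ) ≤ Fintype.card ι * (1 - 2 * p) := by
    have : 0 ≤ 1 - 2 * p := by linarith
    positivity
  constructor
  · exact_mod_cast (by linarith : (l : ℝ) ≤ weight x)
  · exact_mod_cast (by linarith : (weight x + l : ℝ) ≤ Fintype.card ι)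

lemma exists_cube_cover_typical (hp0 : 0 < p) (hp : p < 1 / 2) (hb : 0 ≤ b) {l : ℕ}
    (hl : b ≤ (Fintype.card ι * p - l) * logOdds p) :
    ∃ 𝒞 : Finset ((ι → Bool) × (ι → Bool)),
      (𝒞.card * 4 ^ l : ℝ) ≤ (Fintype.card ι + 1) ^ 3 *
        Real.exp (Fintype.card ι * entropy (bernoulli p) + b) ∧
      (∀ u ∈ 𝒞, hammingDist u.1 u.2 = 2 * l) ∧
      ∀ x ∈ typical ι (bernoulli p) b, ∃ u ∈ 𝒞, x ∈ Set.Icc u.1 u.2 := by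
  have hp1 : p < 1 := by linarith
  have hp₀ := bernoulli_mem_stdSimplex hp0.le hp1.le
  obtain ⟨𝒞, hcard, hdim, hcover⟩ := exists_cube_cover (T := typical ι (bernoulli p) b)
    (fun x hx y hxy => by rwa [mem_typical_bernoulli hp0 hp1, hxy, ← mem_typical_bernoulli hp0 hp1])
    (fun x hx => le_weight_of_mem_typical hp0 hp hl hx)
  refine ⟨𝒞, hcard.trans ?_, hdim, hcover⟩
  set N : ℝ := (Fintype.card ι : ℝ)
  set E := Real.exp (N * entropy (bernoulli p) + b)
  have hN : 0 ≤ N := Nat.cast_nonneg _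
  have hlp : (l : ℝ) ≤ N * p :=
    sub_nonneg.1 (nonneg_of_mul_nonneg_left (hb.trans hl) (logOdds_pos hp0 hp))
  have hlN : 2 * (l : ℝ) ≤ N := by nlinarith
  have hT : ((typical ι (bernoulli p) b).card : ℝ) ≤ E :=
    card_le_exp_of_subset_typical hp₀ subset_rfl
  have hpow : (4 ^ l : ℝ) ≤ E := by
    have hentropy : 2 * p * Real.log 2 ≤ entropy (bernoulli p) := by
      rw [← binaryEntropy_mul_log_two]
      gcongr
      exact (two_mul_lt_binaryEntropy hp0 hp).le
    rw [four_pow_eq_exp]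
    refine Real.exp_le_exp.2 ?_
    calc l * (2 * Real.log 2) ≤ N * p * (2 * Real.log 2) := by gcongr
      _ = N * (2 * p * Real.log 2) := by ring
      _ ≤ N * entropy (bernoulli p) + b := le_add_of_le_of_nonneg (by gcongr) hb
  calc (N + 1) * (N * (2 * l + 1) * (typical ι (bernoulli p) b).card + 4 ^ l)
      ≤ (N + 1) * (N * (N + 1) * E + E) := by gcongr
    _ ≤ (N + 1) * ((N * (N + 1) + (N + 1)) * E) := by
      rw [add_mul _ _ E]
      gcongr
      exact le_mul_of_one_le_left (Real.exp_nonneg _) (le_add_of_nonneg_left hN)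
    _ = (N + 1) ^ 3 * E := by ring

end Typical

lemma eventually_succ_pow_le_exp (k : ℕ) {δ : ℝ} (hδ : 0 < δ) :
    ∀ᶠ n : ℕ in atTop, ((n : ℝ) + 1) ^ k ≤ Real.exp (δ * n) := by
  have hsucc : Tendsto (fun n : ℕ => (n : ℝ) + 1) atTop atTop :=
    tendsto_atTop_add_const_right _ _ tendsto_natCast_atTop_atTop
  filter_upwards [hsucc.eventually ((isLittleO_pow_exp_pos_mul_atTop k hδ).bound
    (Real.exp_pos (-δ)))] with n hn
  rw [Real.norm_of_nonneg (by positivity), Real.norm_of_nonneg (by positivity),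
    ← Real.exp_add] at hn
  exact hn.trans_eq (by ring_nf)

lemma exists_cube_code (hp0 : 0 < p) (hp : p < 1 / 2) {n l : ℕ} {δ R₀ R : ℝ} (hn : 0 < n)
    (hδ : 0 < δ) (hpos : 0 < 1 - varentropy (bernoulli p) / δ ^ 2 / n)
    (hpoly : ((n : ℝ) + 1) ^ 3 ≤ Real.exp (δ * n)) (hl : δ * n ≤ (n * p - l) * logOdds p)
    (hR₀ : 2 * l ≤ n * R₀) (hR : entropy (bernoulli p) + 2 * δ ≤ R * Real.log 2) :
    ∃ c : Code Bool n (numValues n R₀) (numValues n R), c.IsDeterministic ∧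
      1 - varentropy (bernoulli p) / δ ^ 2 / n ≤ c.successProb (bernoulli p) ∧
      ∀ η : ℝ, 0 ≤ η → η ≤ 1 / 2 →
        (n : ℝ)⁻¹ * ((1 - 2 * η) * l * (1 - varentropy (bernoulli p) / δ ^ 2 / n -
          2 * Real.exp (3 * δ * n - 4 * η ^ 2 * l))) ≤
        c.forcedDistortion (bernoulli p) hamming := by
  have hp₀ := bernoulli_mem_stdSimplex hp0.le (by linarith : p ≤ 1)
  have hsum := one_sub_div_le_sum_typical (ι := Fin n) hp₀ hn (by simp) hδ
  obtain ⟨𝒞, hcard, hdim, hcover⟩ := exists_cube_cover_typical (ι := Fin n) hp0 hp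
    (b := δ * n) (by positivity)
    (by simpa using hl)
  have htypical : ∀ x ∈ typical (Fin n) (bernoulli p) (δ * n), iidProb (bernoulli p) x ≤ _ :=
    fun x hx => (mem_typical.1 hx).2
  have hnonempty : (typical (Fin n) (bernoulli p) (δ * n)).Nonempty :=
    Finset.nonempty_of_sum_ne_zero (hpos.trans_le hsum).ne'
  rw [Fintype.card_fin] at hcard htypical
  set H := entropy (bernoulli p)
  have hsize : (𝒞.card * 4 ^ l : ℝ) ≤ Real.exp (n * H + 2 * δ * n) := by
    refine hcard.trans ((mul_le_mul_of_nonneg_right hpoly (Real.exp_nonneg _)).trans_eq ?_)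
    rw [← Real.exp_add]
    ring_nf
  have hK : 4 ^ l ≤ numValues n R₀ := le_numValues <| by
    rw [Nat.cast_pow, Nat.cast_ofNat, four_pow_eq_exp, Real.exp_le_exp]
    linarith [mul_le_mul_of_nonneg_right hR₀ (Real.log_pos one_lt_two).le]
  have hM : 𝒞.card * 4 ^ l ≤ numValues n R := le_numValues <| by
    push_cast
    refine hsize.trans (Real.exp_le_exp.2 ?_)
    linarith [mul_le_mul_of_nonneg_left hR (n.cast_nonneg (α := ℝ))]
  obtain ⟨c, hdet, hsuccess, hforced⟩ := Code.exists_le_forcedDistortion_of_cube_cover hp₀.1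
    hnonempty htypical hdim hcover hK hM
  refine ⟨c, hdet, hsum.trans hsuccess, fun η hη₀ hη => le_trans ?_ (hforced η hη₀ hη)⟩
  have hη₂ : 0 ≤ 1 - 2 * η := by linarith
  gcongr _ * (_ * (?_ - ?_))
  calc 2 * (𝒞.card * 4 ^ l) * Real.exp (-(4 * η ^ 2 * l)) * Real.exp (-(n * H) + δ * n)
      ≤ 2 * Real.exp (n * H + 2 * δ * n) * Real.exp (-(4 * η ^ 2 * l)) *
        Real.exp (-(n * H) + δ * n) := by gcongr
    _ = 2 * Real.exp (3 * δ * n - 4 * η ^ 2 * l) := by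
      rw [mul_assoc, mul_assoc, ← Real.exp_add, ← Real.exp_add]
      ring_nf

lemma tendsto_inv_mul_floor_mul {a θ κ : ℝ} (ha : 0 ≤ a) (hκ : κ < θ * a) (r V : ℝ) :
    Tendsto (fun n : ℕ => (n : ℝ)⁻¹ *
      (r * ⌊a * n⌋₊ * (1 - V / n - 2 * Real.exp (κ * n - θ * ⌊a * n⌋₊)))) atTop (𝓝 (r * a)) := by
  have hfloor : Tendsto (fun n : ℕ => (⌊a * n⌋₊ : ℝ) / n) atTop (𝓝 a) :=
    (tendsto_nat_floor_mul_div_atTop ha).comp tendsto_natCast_atTop_atTop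
  have hexp : Tendsto (fun n : ℕ => Real.exp (κ * n - θ * ⌊a * n⌋₊)) atTop (𝓝 0) := by
    refine Real.tendsto_exp_atBot.comp ((tendsto_natCast_atTop_atTop.atTop_mul_neg
      (sub_neg.2 hκ) ((hfloor.const_mul θ).const_sub κ)).congr' ?_)
    filter_upwards [eventually_gt_atTop 0] with n hn
    field_simp
  have hlim := (hfloor.const_mul r).mul ((tendsto_one_sub_const_div V).sub (hexp.const_mul 2))
  rw [mul_zero, sub_zero, mul_one] at hlim
  exact hlim.congr fun n => by ring

lemma eventually_exists_cube_code (hp0 : 0 < p) (hp : p < 1 / 2) {D R₀ R : ℝ} (hR₀ : 0 < R₀)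
    (hD : D < min (R₀ / 2) p) (hR : binaryEntropy p < R) :
    ∃ V : ℝ, ∀ᶠ n : ℕ in atTop, ∃ c : Code Bool n (numValues n R₀) (numValues n R),
      c.IsDeterministic ∧ 1 - V / n ≤ c.successProb (bernoulli p) ∧
      D ≤ c.forcedDistortion (bernoulli p) hamming := by
  obtain ⟨a, hDa, ha⟩ := exists_between (max_lt hD (lt_min (half_pos hR₀) hp0))
  obtain ⟨hDa, ha₀⟩ := max_lt_iff.1 hDa
  obtain ⟨haR₀, hap⟩ := lt_min_iff.1 ha
  obtain ⟨η, hDη, hη, hη₀⟩ : ∃ η : ℝ, D < (1 - 2 * η) * a ∧ η ≤ 1 / 2 ∧ 0 < η := by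
    have hcont : Tendsto (fun η : ℝ => (1 - 2 * η) * a) (𝓝[>] 0) (𝓝 a) :=
      (Continuous.tendsto' (by fun_prop) _ _ (by simp)).mono_left nhdsWithin_le_nhds
    exact ((hcont.eventually_const_lt hDa).and ((eventually_le_nhds (by norm_num)).filter_mono
      nhdsWithin_le_nhds |>.and self_mem_nhdsWithin)).exists
  have hlog : entropy (bernoulli p) < R * Real.log 2 := by
    rw [← binaryEntropy_mul_log_two]
    exact mul_lt_mul_of_pos_right hR (Real.log_pos one_lt_two)
  obtain ⟨δ, hδ, hδ'⟩ := exists_between (show 0 < min ((p - a) * logOdds p)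
    (min ((R * Real.log 2 - entropy (bernoulli p)) / 2) (4 * η ^ 2 * a / 3)) from
      lt_min (mul_pos (sub_pos.2 hap) (logOdds_pos hp0 hp))
        (lt_min (half_pos (sub_pos.2 hlog)) (by positivity)))
  obtain ⟨hδa, hδ'⟩ := lt_min_iff.1 hδ'
  obtain ⟨hδR, hδη⟩ := lt_min_iff.1 hδ'
  refine ⟨varentropy (bernoulli p) / δ ^ 2, ?_⟩
  filter_upwards [eventually_succ_pow_le_exp 3 hδ, eventually_gt_atTop 0,
    (tendsto_one_sub_const_div (varentropy (bernoulli p) / δ ^ 2)).eventually_const_lt one_pos,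
    (tendsto_inv_mul_floor_mul ha₀.le (by linarith : 3 * δ < 4 * η ^ 2 * a) (1 - 2 * η)
      (varentropy (bernoulli p) / δ ^ 2)).eventually_const_lt hDη] with n hpoly hn hpos hforced
  have hfloor : (⌊a * n⌋₊ : ℝ) ≤ a * n := Nat.floor_le (by positivity)
  have hodds := logOdds_pos hp0 hp
  have hroom : δ * n ≤ (n * p - ⌊a * n⌋₊) * logOdds p :=
    calc δ * n ≤ (p - a) * logOdds p * n := by gcongr
      _ = (n * p - a * n) * logOdds p := by ring
      _ ≤ (n * p - ⌊a * n⌋₊) * logOdds p := by gcongr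
  have hkey : 2 * (⌊a * n⌋₊ : ℝ) ≤ n * R₀ :=
    calc 2 * (⌊a * n⌋₊ : ℝ) ≤ 2 * (R₀ / 2 * n) := by gcongr; exact hfloor.trans (by gcongr)
      _ = n * R₀ := by ring
  obtain ⟨c, hdet, hsuccess, hc⟩ :=
    exists_cube_code (R := R) hp0 hp hn hδ hpos hpoly hroom hkey (by linarith)
  exact ⟨c, hdet, hsuccess, hforced.le.trans (hc η hη₀.le hη)⟩

lemma canForce_of_lt (k : CodeClass) (hp0 : 0 < p) (hp : p < 1 / 2) {D R₀ R : ℝ} (hR₀ : 0 < R₀)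
    (hD : D < min (R₀ / 2) p) (hR : binaryEntropy p < R) :
    CanForce k (bernoulli p) hamming R₀ R D := by
  have hp₀ := bernoulli_mem_stdSimplex hp0.le (by linarith : p ≤ 1)
  have hK := fun n => numValues_pos n hR₀.le
  obtain ⟨V, hcodes⟩ := eventually_exists_cube_code hp0 hp hR₀ hD hR
  obtain ⟨c, hdet, hc, hforced⟩ := exists_code_sequence hp₀ hK
    (fun n => numValues_pos n ((binaryEntropy_pos hp0 hp).trans hR).le)
    (tendsto_one_sub_const_div V)
    (Q := fun n c => 1 ≤ n → D ≤ c.forcedDistortion (bernoulli p) hamming)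
    (fun n c hsecret hn => by
      rw [hsecret.forcedDistortion_eq hn (hK n) hp₀, blindDistortion_bernoulli hp.le]
      exact (lt_min_iff.1 hD).2.le)
    (hcodes.mono fun n ⟨c, hdet, hsuccess, hforced⟩ => ⟨c, hdet, hsuccess, fun _ => hforced⟩)
  exact ⟨c, fun n => (hdet n).inClass k, hc, hforced⟩

end Bernoulli

/-! ### The regions -/

section Region

lemma mem_closure_of_forall_pos {X : Type*} [TopologicalSpace X] {s : Set X} {x : X} (f : ℝ → X)
    (hf : Continuous f) (hx : f 0 = x) (hs : ∀ ε > 0, f ε ∈ s) : x ∈ closure s :=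
  mem_closure_of_tendsto ((hf.tendsto' 0 x hx).mono_left (nhdsWithin_le_nhds (s := Set.Ioi 0)))
    (eventually_mem_nhdsWithin.mono hs)

theorem isGreatest_secrecyRegion (k : CodeClass) {p R₀ R : ℝ} (hp0 : 0 < p) (hp : p < 1 / 2)
    (hR₀ : 0 ≤ R₀) (hR : binaryEntropy p ≤ R) :
    IsGreatest {D : ℝ | (R₀, R, D) ∈ secrecyRegion k (bernoulli p) hamming}
      (min (R₀ / 2) p) := by
  have hp₀ := bernoulli_mem_stdSimplex hp0.le (by linarith : p ≤ 1)
  constructor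
  · rw [Set.mem_ofPred_eq, secrecyRegion]
    exact mem_closure_of_forall_pos (fun ε => (R₀ + ε, R + ε, min (R₀ / 2) p - ε))
      (by fun_prop) (by simp) fun ε hε => canForce_of_lt k hp0 hp (by positivity)
        (lt_min (by linarith [min_le_left (R₀ / 2) p]) (by linarith [min_le_right (R₀ / 2) p]))
        (by linarith)
  · intro D hD
    refine closure_minimal (t := {t : ℝ × ℝ × ℝ | t.2.2 ≤ min (t.1 / 2) p}) (fun t ht => ?_)
      (isClosed_le (by fun_prop) (by fun_prop)) hD
    exact le_min (ht.le_half_key_rate hp₀)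
      ((ht.le_blindDistortion hp₀.2).trans_eq (blindDistortion_bernoulli hp.le))

variable {𝒳 : Type} [Fintype 𝒳] {p₀ : 𝒳 → ℝ} {R₀ R : ℝ}

theorem isGreatest_naiveRegion (k : CodeClass) (hp₀ : p₀ ∈ stdSimplex ℝ 𝒳)
    (hH : 0 < entropy p₀) {d : 𝒳 → 𝒳 → ℝ} (hd₀ : ∀ a b, 0 ≤ d a b) (hd₁ : ∀ a b, d a b ≤ 1)
    (hd : ∀ a, d a a = 0) (hR₀ : 0 ≤ R₀) (hR₀H : R₀ ≤ entropy p₀ / Real.log 2)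
    (hR : entropy p₀ / Real.log 2 ≤ R) :
    IsGreatest {D : ℝ | (R₀, R, D) ∈ naiveRegion k p₀ d}
      (R₀ / (entropy p₀ / Real.log 2) * blindDistortion p₀ d) := by
  have hlog : 0 < Real.log 2 := Real.log_pos one_lt_two
  have hbits : 0 < entropy p₀ / Real.log 2 := div_pos hH hlog
  set β := R₀ / (entropy p₀ / Real.log 2) with hβ
  have hβ₁ : β ≤ 1 := (div_le_one hbits).2 hR₀H
  have hβH : β * entropy p₀ = R₀ * Real.log 2 := by
    rw [hβ]
    field_simp
  rw [div_le_iff₀ hlog] at hR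
  have := nonempty_of_sum_eq_one hp₀.2
  constructor
  · rw [Set.mem_ofPred_eq, naiveRegion]
    refine mem_closure_of_forall_pos (fun ε => (R₀ + ε, R + 2 * ε, β * blindDistortion p₀ d))
      (by fun_prop) (by simp) fun ε hε => ?_
    have hεlog := mul_pos hε hlog
    exact canForceNaively_mul_blindDistortion k hp₀ hd₀ (by positivity) hβ₁
      (by linarith) (by linarith)
  · intro D hD
    have hle : D * entropy p₀ ≤ R₀ * Real.log 2 * blindDistortion p₀ d := closure_minimal
      (t := {t : ℝ × ℝ × ℝ | t.2.2 * entropy p₀ ≤ t.1 * Real.log 2 * blindDistortion p₀ d})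
      (fun t ht => ht.mul_entropy_le hp₀ hd₀ hd₁ hd) (isClosed_le (by fun_prop) (by fun_prop)) hD
    refine le_of_mul_le_mul_right (hle.trans_eq ?_) hH
    rw [← hβH]
    ring

theorem isLeast_perfectSecrecyRegion (k : CodeClass) (hp₀ : p₀ ∈ stdSimplex ℝ 𝒳)
    (hR : entropy p₀ / Real.log 2 ≤ R) :
    IsLeast {R₀ : ℝ | (R₀, R) ∈ perfectSecrecyRegion k p₀} (entropy p₀ / Real.log 2) := by
  have hlog : 0 < Real.log 2 := Real.log_pos one_lt_two
  constructor
  · rw [Set.mem_ofPred_eq, perfectSecrecyRegion]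
    exact mem_closure_of_forall_pos (fun ε => (entropy p₀ / Real.log 2 + ε, R + 2 * ε))
      (by fun_prop) (by simp) fun ε hε => exists_perfectlySecret_sequence k hp₀
        ((div_lt_iff₀ hlog).1 (lt_add_of_pos_right _ hε)) (by linarith)
  · intro R₀ hR₀
    refine closure_minimal (t := {t : ℝ × ℝ | entropy p₀ / Real.log 2 ≤ t.1})
      (fun t ht => ?_) (isClosed_le (by fun_prop) (by fun_prop)) hR₀
    obtain ⟨c, -, hsecret, hc⟩ := ht
    exact (div_le_iff₀ hlog).2
      (entropy_le_of_perfectlySecret hp₀ (fun n => numValues_le_exp n t.1) hsecret hc)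

theorem isGreatest_naiveRegion_bernoulli (k : CodeClass) {p : ℝ} (hp0 : 0 < p) (hp : p < 1 / 2)
    (hR₀ : 0 ≤ R₀) (hR₀H : R₀ ≤ binaryEntropy p) (hR : binaryEntropy p ≤ R) :
    IsGreatest {D : ℝ | (R₀, R, D) ∈ naiveRegion k (bernoulli p) hamming}
      (R₀ / binaryEntropy p * p) := by
  have hp₀ := bernoulli_mem_stdSimplex hp0.le (by linarith : p ≤ 1)
  have hH : 0 < entropy (bernoulli p) := by
    rw [entropy_bernoulli]
    exact Real.binEntropy_pos hp0 (by linarith)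
  have hbits : entropy (bernoulli p) / Real.log 2 = binaryEntropy p := by
    rw [entropy_bernoulli, binaryEntropy]
  rw [← hbits] at hR₀H hR ⊢
  nth_rewrite 3 [← blindDistortion_bernoulli hp.le]
  exact isGreatest_naiveRegion k hp₀ hH hamming_nonneg hamming_le_one hamming_self hR₀ hR₀H hR

theorem isLeast_perfectSecrecyRegion_bernoulli (k : CodeClass) {p : ℝ} (hp0 : 0 ≤ p) (hp : p ≤ 1)
    (hR : binaryEntropy p ≤ R) :
    IsLeast {R₀ : ℝ | (R₀, R) ∈ perfectSecrecyRegion k (bernoulli p)} (binaryEntropy p) := by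
  have hbits : binaryEntropy p = entropy (bernoulli p) / Real.log 2 := by
    rw [entropy_bernoulli, binaryEntropy]
  rw [hbits] at hR ⊢
  exact isLeast_perfectSecrecyRegion k (bernoulli_mem_stdSimplex hp0 hp) hR

end Region

end PartialSecrecy

end

theorem mainTheorem3 (p : ℝ) (hp0 : 0 < p) (hp : p < 1 / 2) :
    -- the optimal forced distortion below key rate `2p`
    (∀ (k : PartialSecrecy.CodeClass) (R₀ R : ℝ),
      0 ≤ R₀ → R₀ < 2 * p → PartialSecrecy.binaryEntropy p ≤ R →
      IsGreatest {D : ℝ | (R₀, R, D) ∈ PartialSecrecy.secrecyRegion k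
        (PartialSecrecy.bernoulli p) PartialSecrecy.hamming} (R₀ / 2)) ∧
    -- the full distortion `p` is forced, and is optimal, from key rate `2p < H(p)` on
    (∀ (k : PartialSecrecy.CodeClass) (R₀ R : ℝ),
      2 * p ≤ R₀ → PartialSecrecy.binaryEntropy p ≤ R →
      IsGreatest {D : ℝ | (R₀, R, D) ∈ PartialSecrecy.secrecyRegion k
        (PartialSecrecy.bernoulli p) PartialSecrecy.hamming} p) ∧
    2 * p < PartialSecrecy.binaryEntropy p ∧
    -- perfect secrecy forces distortion exactly `p`, and requires key rate `H(p)`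
    (∀ (n K M : ℕ) (c : PartialSecrecy.Code Bool n K M), 1 ≤ n → 1 ≤ K →
      c.PerfectlySecret (PartialSecrecy.bernoulli p) →
      c.forcedDistortion (PartialSecrecy.bernoulli p) PartialSecrecy.hamming = p) ∧
    (∀ (k : PartialSecrecy.CodeClass) (R : ℝ), PartialSecrecy.binaryEntropy p ≤ R →
      IsLeast {R₀ : ℝ | (R₀, R) ∈ PartialSecrecy.perfectSecrecyRegion k
        (PartialSecrecy.bernoulli p)} (PartialSecrecy.binaryEntropy p)) ∧
    -- naive prefix hiding is strictly suboptimal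
    (∀ (k : PartialSecrecy.CodeClass) (R₀ R : ℝ),
      0 < R₀ → R₀ < PartialSecrecy.binaryEntropy p → PartialSecrecy.binaryEntropy p ≤ R →
      ∃ D D' : ℝ,
        IsGreatest {D : ℝ | (R₀, R, D) ∈ PartialSecrecy.naiveRegion k
          (PartialSecrecy.bernoulli p) PartialSecrecy.hamming} D ∧
        IsGreatest {D : ℝ | (R₀, R, D) ∈ PartialSecrecy.secrecyRegion k
          (PartialSecrecy.bernoulli p) PartialSecrecy.hamming} D' ∧
        D = R₀ / PartialSecrecy.binaryEntropy p * p ∧ D < D') := by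
  have hchord := PartialSecrecy.two_mul_lt_binaryEntropy hp0 hp
  have hH := PartialSecrecy.binaryEntropy_pos hp0 hp
  have hp1 : p ≤ 1 := by linarith
  have hregion (k : PartialSecrecy.CodeClass) (R₀ R : ℝ) :=
    PartialSecrecy.isGreatest_secrecyRegion k (R₀ := R₀) (R := R) hp0 hp
  refine ⟨fun k R₀ R hR₀ hlt hR => ?_, fun k R₀ R hle hR => ?_, hchord, fun n K M c hn hK hc => ?_,
    fun k R hR => PartialSecrecy.isLeast_perfectSecrecyRegion_bernoulli k hp0.le hp1 hR,
    fun k R₀ R hR₀ hlt hR => ⟨_, _, PartialSecrecy.isGreatest_naiveRegion_bernoulli k hp0 hp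
      hR₀.le hlt.le hR, hregion k R₀ R hR₀.le hR, rfl, lt_min ?_ ?_⟩⟩
  · simpa only [min_eq_left (by linarith : R₀ / 2 ≤ p)] using hregion k R₀ R hR₀ hR
  · simpa only [min_eq_right (by linarith : p ≤ R₀ / 2)] using hregion k R₀ R (by linarith) hR
  · exact (hc.forcedDistortion_eq hn hK (PartialSecrecy.bernoulli_mem_stdSimplex hp0.le hp1)).trans
      (PartialSecrecy.blindDistortion_bernoulli hp.le)
  · rw [div_mul_eq_mul_div, div_lt_div_iff₀ hH two_pos, mul_assoc]
    exact mul_lt_mul_of_pos_left (by linarith) hR₀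
  · exact mul_lt_of_lt_one_left hp0 ((div_lt_one hH).2 hlt)
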